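/- Let $F_2$ be the free group on $x_1, x_2$, let $k\in\mathbb Z$ and $\varepsilon,\delta\in\{1,-1\}$, and let $G = F_2\rtimes(\mathbb Z\times\mathbb Z/2)$, where the generator $t_1$ of $\mathbb Z/2$ acts by $$t_1(x_1)=x_1^{-1},\qquad t_1(x_2)=x_2,$$ and the generator $t_2$ of $\mathbb Z$ acts by $$t_2(x_1)=x_2^{k}x_1^{\varepsilon}x_2^{-k},\qquad t_2(x_2)=x_2^{\delta}.$$ Then $G$ is a CAT(0) group, that is, it acts properly and cocompactly by isometries on a nonempty CAT(0) space. Moreover, with $\xi=x_2^{-k}t_2$, $L_1=\langle x_2,t_1,\xi\rangle$, $L_2=\langle x_1,t_1,\xi\rangle$ and $L=\langle t_1,\xi\rangle$, the group $G$ is the amalgamated free product $L_1*_L L_2$ of these subgroups, where $L_1\cong\mathbb Z^2\times\mathbb Z/2$ if $\delta=1$, $L_1\cong\mathbb Z/2\times(\mathbb Z\rtimes\mathbb Z)$ if $\delta=-1$ (the generator of the second factor $\mathbb Z$ acting on the first by inversion), $L_2\cong\mathbb Z\times D_\infty$ with $D_\infty$ the infinite dihedral group, and $L\cong\mathbb Z\times\mathbb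 Z/2$. -/

import Mathlib

/-- `S` is a geodesic segment with endpoints `a` and `b`: the image of a path
`γ : [0, d(a, b)] → X` from `a` to `b` that preserves distances. -/
def IsGeodesicSegment {X : Type*} [MetricSpace X] (a b : X) (S : Set X) : Prop :=
  ∃ γ : ℝ → X, γ 0 = a ∧ γ (dist a b) = b ∧
    (∀ s ∈ Set.Icc 0 (dist a b), ∀ t ∈ Set.Icc 0 (dist a b), dist (γ s) (γ t) = |s - t|) ∧
    S = γ '' Set.Icc 0 (dist a b)

/-- A CAT(0) space: any two points are joined by a geodesic segment, and every geodesic triangle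
is at least as thin as its comparison triangle in the Euclidean plane. The triangle has vertices
`a`, `b`, `c` and sides `S₁ = [a, b]`, `S₂ = [a, c]`, `S₃ = [b, c]`; the primed points are those of
the comparison triangle. Any two different sides share a vertex, which is called `a` here, and for
two points on one side both distances agree. -/
def IsCAT0Space (X : Type*) [MetricSpace X] : Prop :=
  (∀ x y : X, ∃ S : Set X, IsGeodesicSegment x y S) ∧
  ∀ (a b c : X) (S₁ S₂ S₃ : Set X),
    IsGeodesicSegment a b S₁ → IsGeodesicSegment a c S₂ → IsGeodesicSegment b c S₃ →
    ∀ a' b' c' : EuclideanSpace ℝ (Fin 2),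
      dist a' b' = dist a b → dist a' c' = dist a c → dist b' c' = dist b c →
      ∀ p ∈ S₁, ∀ q ∈ S₂, ∀ p' ∈ segment ℝ a' b', ∀ q' ∈ segment ℝ a' c',
        dist a' p' = dist a p → dist a' q' = dist a q → dist p q ≤ dist p' q'

/-- A CAT(0) group: a group that acts properly and cocompactly by isometries on a nonempty CAT(0)
space. The action is proper if every point has a ball that meets only finitely many of its
translates, and cocompact if the translates of some compact set cover the space. -/
def IsCAT0Group (G : Type*) [Group G] : Prop :=
  ∃ (X : Type) (_ : MetricSpace X) (_ : MulAction G X),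
    Nonempty X ∧ IsCAT0Space X ∧
    (∀ (g : G) (x y : X), dist (g • x) (g • y) = dist x y) ∧
    (∀ x : X, ∃ r > 0,
      {g : G | (((fun y => g • y) '' Metric.ball x r) ∩ Metric.ball x r).Nonempty}.Finite) ∧
    ∃ K : Set X, IsCompact K ∧ ∀ x : X, ∃ g : G, ∃ y ∈ K, g • y = x

/-- `G` is the free product of its subgroups `A i` with amalgamation along the common
subgroup `L`: the canonical map from the pushout of the inclusions `L → A i` to `G` is bijective. -/
def IsAmalgam {G : Type*} [Group G] {ι : Type*} (A : ι → Subgroup G) (L : Subgroup G) : Prop :=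
  ∃ h : ∀ i, L ≤ A i,
    Function.Bijective
      (Monoid.PushoutI.lift (φ := fun i => Subgroup.inclusion (h i))
        (fun i => (A i).subtype) L.subtype (fun _ => rfl))

/-- The action of `ℤ` on `ℤ` in which the generator acts by inversion. -/
def inversionAction : Multiplicative ℤ →* MulAut (Multiplicative ℤ) :=
  zpowersHom (MulAut (Multiplicative ℤ)) (MulEquiv.inv (Multiplicative ℤ))

/-!
With `ξ = x₂⁻ᵏ t₂` the action becomes diagonal: conjugation by `ξ` maps `x₁` to `x₁ ^ ε` and `x₂` to
`x₂ ^ δ`, and `ξ` commutes with `t₁`. Hence `G` is the semidirect product of the free group by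
`⟨ξ⟩ × ⟨t₁⟩ ≅ ℤ × ℤ/2`, acting by changes of signs of the free generators. The structure
`IsSignExtension` records this through the relations, normal forms and the universal property; the
rest of the argument only uses these (`isSignExtension_semidirectProduct`).

*Amalgam and factors.* None of the relations involves both `x₁` and `x₂`, so that the universal
property provides a homomorphism from `G` to the amalgam, inverse to the canonical map
(`IsSignExtension.isAmalgam`). Killing one or both of `x₁` and `x₂` maps `G` to the
groups which are claimed to be isomorphic to the subgroups; homomorphisms in the other direction
show that the restrictions to the subgroups are injective (`nonempty_closure_mulEquiv`). If
`ε = -1`, then `ξ t₁` instead of `ξ` commutes with `x₁`.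

*CAT(0).* Changes of signs preserve the lengths of reduced words, so `G` acts on the Cayley tree of
the free group, with `t₁` and `ξ` fixing the vertex `1`. Letting `ξ` also translate a line,
one obtains a proper and cocompact action on the product of the tree and the line
(`IsSignExtension.isCAT0Group`). To see that the product is CAT(0), the comparison condition for
all triangles is reduced to the Bruhat–Tits inequality for a vertex and a point of the opposite side
(`SatisfiesCN.isCAT0Space`), which passes to `ℓ²`-products and holds in 0-hyperbolic geodesic
spaces. The tree is constructed as the tight span of the vertex set with the word metric
(`TightSpan`): the four point condition passes from a metric space to its tight span,
and for free groups it is the ultrametric inequality for lengths of common prefixes of reduced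
words (`FreeGroup.isZeroHyperbolic`).
-/

/-! ### The Bruhat–Tits inequality -/

/-- The Bruhat–Tits (CN) inequality for all points of a segment: for all `q`, `r` and `t ∈ [0, 1]`
there is a point `m` whose distance to any point `p` is at most the distance in the Euclidean
plane between the vertex `p` of a comparison triangle and the point dividing the opposite side
`[q, r]` in the ratio `t : 1 - t`. -/
def SatisfiesCN (X : Type*) [MetricSpace X] : Prop :=
  ∀ q r : X, ∀ t ∈ Set.Icc (0 : ℝ) 1, ∃ m : X, ∀ p : X,
    dist p m ^ 2 ≤ (1 - t) * dist p q ^ 2 + t * dist p r ^ 2 - t * (1 - t) * dist q r ^ 2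

namespace SatisfiesCN

variable {X : Type*} [MetricSpace X]

/-- The point `m` of the inequality is the only point which divides `[q, r]` in the given ratio. -/
theorem eq_of_forall_dist_sq_le {q r m m' : X} {t : ℝ} (ht : t ∈ Set.Icc (0 : ℝ) 1)
    (h₁ : dist q m ≤ t * dist q r) (h₂ : dist m r ≤ (1 - t) * dist q r)
    (hm' : ∀ p : X, dist p m' ^ 2 ≤
      (1 - t) * dist p q ^ 2 + t * dist p r ^ 2 - t * (1 - t) * dist q r ^ 2) : m = m' := by
  have k := hm' m
  rw [dist_comm m q] at k
  have k₁ : dist q m ^ 2 ≤ (t * dist q r) ^ 2 := by gcongr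
  have k₂ : dist m r ^ 2 ≤ ((1 - t) * dist q r) ^ 2 := by gcongr
  have k₃ := mul_le_mul_of_nonneg_left k₁ (sub_nonneg.2 ht.2)
  have k₄ := mul_le_mul_of_nonneg_left k₂ ht.1
  have k₅ : dist m m' ^ 2 ≤ 0 := by linarith
  exact dist_eq_zero.1 (pow_eq_zero_iff two_ne_zero |>.1 (le_antisymm k₅ (sq_nonneg _)))

theorem dist_sq_le (h : SatisfiesCN X) {q r m : X} {t : ℝ} (ht : t ∈ Set.Icc (0 : ℝ) 1)
    (h₁ : dist q m ≤ t * dist q r) (h₂ : dist m r ≤ (1 - t) * dist q r) (p : X) :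
    dist p m ^ 2 ≤ (1 - t) * dist p q ^ 2 + t * dist p r ^ 2 - t * (1 - t) * dist q r ^ 2 := by
  obtain ⟨m', hm'⟩ := h q r t ht
  exact eq_of_forall_dist_sq_le ht h₁ h₂ hm' ▸ hm' p

theorem eq_of_dist_le (h : SatisfiesCN X) {q r m m' : X} {t : ℝ} (ht : t ∈ Set.Icc (0 : ℝ) 1)
    (h₁ : dist q m ≤ t * dist q r) (h₂ : dist m r ≤ (1 - t) * dist q r)
    (h₁' : dist q m' ≤ t * dist q r) (h₂' : dist m' r ≤ (1 - t) * dist q r) : m = m' :=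
  eq_of_forall_dist_sq_le ht h₁ h₂ (h.dist_sq_le ht h₁' h₂')

theorem exists_isometric_path (h : SatisfiesCN X) (a b : X) :
    ∃ γ : ℝ → X, γ 0 = a ∧ γ (dist a b) = b ∧
      ∀ s ∈ Set.Icc 0 (dist a b), ∀ t ∈ Set.Icc 0 (dist a b), dist (γ s) (γ t) = |s - t| := by
  have : Nonempty X := ⟨a⟩
  choose! m hm using h a b
  set D := dist a b with hD
  have key : ∀ t ∈ Set.Icc (0 : ℝ) 1, dist a (m t) ≤ t * D ∧ dist (m t) b ≤ (1 - t) * D := by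
    intro t ht
    have h₁ := hm t ht a
    have h₂ := hm t ht b
    rw [dist_self, ← hD] at h₁
    rw [dist_self, dist_comm b a, ← hD, dist_comm b] at h₂
    have hD0 : 0 ≤ D := dist_nonneg
    exact ⟨(le_abs_self _).trans (abs_le_of_sq_le_sq (by linarith) (mul_nonneg ht.1 hD0)),
      (le_abs_self _).trans
        (abs_le_of_sq_le_sq (by linarith) (mul_nonneg (sub_nonneg.2 ht.2) hD0))⟩
  rcases (dist_nonneg : 0 ≤ dist a b).eq_or_lt with h0 | hpos
  · have hab : a = b := dist_eq_zero.1 h0.symm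
    refine ⟨fun _ => a, rfl, hab, fun s hs t ht => ?_⟩
    rw [hD, ← h0] at hs ht
    rw [le_antisymm hs.2 hs.1, le_antisymm ht.2 ht.1]
    simp
  rw [← hD] at hpos
  have hmem : ∀ s ∈ Set.Icc 0 D, s / D ∈ Set.Icc (0 : ℝ) 1 := fun s hs =>
    ⟨div_nonneg hs.1 hpos.le, (div_le_one hpos).2 hs.2⟩
  refine ⟨fun s => m (s / D), ?_, ?_, ?_⟩
  · have k := (key 0 ⟨le_rfl, zero_le_one⟩).1
    rw [zero_mul] at k
    simpa using (dist_le_zero.1 k).symm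
  · have k := (key 1 ⟨zero_le_one, le_rfl⟩).2
    rw [sub_self, zero_mul] at k
    simpa [div_self hpos.ne'] using dist_le_zero.1 k
  · intro s hs t ht
    have hs' := hmem s hs
    have ht' := hmem t ht
    obtain ⟨s₁, s₂⟩ := key _ hs'
    obtain ⟨t₁, t₂⟩ := key _ ht'
    have k := h.dist_sq_le ht' t₁ t₂ (m (s / D))
    have k₁ : dist (m (s / D)) a ^ 2 ≤ (s / D * D) ^ 2 := by rw [dist_comm]; gcongr
    have k₂ : dist (m (s / D)) b ^ 2 ≤ ((1 - s / D) * D) ^ 2 := by gcongr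
    have k₃ := mul_le_mul_of_nonneg_left k₁ (sub_nonneg.2 ht'.2)
    have k₄ := mul_le_mul_of_nonneg_left k₂ ht'.1
    have k₅ : dist (m (s / D)) (m (t / D)) ^ 2 ≤ (s / D * D - t / D * D) ^ 2 := by
      rw [← hD] at k; linarith
    rw [div_mul_cancel₀ _ hpos.ne'] at k₅ s₁ t₁
    rw [div_mul_cancel₀ _ hpos.ne'] at k₅
    rw [sub_mul, div_mul_cancel₀ _ hpos.ne'] at s₂ t₂
    refine le_antisymm ((le_abs_self _).trans (sq_le_sq.1 k₅)) ?_
    -- For `s ≤ t`, going from `a` to `b` through both points gives `D ≤ s + d + (D - t)`.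
    have r₁ := dist_triangle4 a (m (s / D)) (m (t / D)) b
    have r₂ := dist_triangle4 a (m (t / D)) (m (s / D)) b
    rw [dist_comm (m (t / D)) (m (s / D))] at r₂
    rw [abs_le]
    constructor <;> linarith

/-- Geodesic segments are compact and contain all points between their endpoints. -/
theorem exists_isCompact_of_dist_add_dist_le (h : SatisfiesCN X) (a b : X) :
    ∃ K : Set X, IsCompact K ∧ ∀ p, dist a p + dist p b ≤ dist a b → p ∈ K := by
  obtain ⟨γ, h0, h1, hγ⟩ := h.exists_isometric_path a b
  have hcont : ContinuousOn γ (Set.Icc 0 (dist a b)) :=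
    (LipschitzOnWith.of_dist_le_mul (K := 1) fun s hs t ht => by
      rw [hγ s hs t ht, NNReal.coe_one, one_mul, Real.dist_eq]).continuousOn
  refine ⟨_, isCompact_Icc.image_of_continuousOn hcont, fun p hp => ?_⟩
  have hD : 0 ≤ dist a b := dist_nonneg
  have hs : dist a p ∈ Set.Icc 0 (dist a b) :=
    ⟨dist_nonneg, by linarith [dist_nonneg (x := p) (y := b)]⟩
  refine ⟨dist a p, hs, ?_⟩
  have k₁ := hγ 0 ⟨le_rfl, hD⟩ _ hs
  have k₂ := hγ _ hs (dist a b) ⟨hD, le_rfl⟩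
  rw [h0, zero_sub, abs_neg, abs_of_nonneg hs.1] at k₁
  rw [h1, abs_sub_comm, abs_of_nonneg (sub_nonneg.2 hs.2)] at k₂
  rcases hD.eq_or_lt with h' | h'
  · have e₁ : dist a (γ (dist a p)) = 0 := by linarith [hs.1, hs.2]
    have e₂ : dist a p = 0 := by linarith [hs.1, hs.2]
    rw [← dist_eq_zero.1 e₁, ← dist_eq_zero.1 e₂]
  · have e : dist a p / dist a b * dist a b = dist a p := div_mul_cancel₀ _ h'.ne'
    refine h.eq_of_dist_le (q := a) (r := b)
      ⟨div_nonneg hs.1 hD, (div_le_one h').2 hs.2⟩ ?_ ?_ ?_ ?_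
    · rw [e, k₁]
    · rw [sub_mul, e, k₂, one_mul]
    · rw [e]
    · rw [sub_mul, e]; linarith

end SatisfiesCN

theorem norm_sq_one_sub_smul_add_smul {E : Type*} [NormedAddCommGroup E] [InnerProductSpace ℝ E]
    (t : ℝ) (x y : E) :
    ‖(1 - t) • x + t • y‖ ^ 2 =
      (1 - t) * ‖x‖ ^ 2 + t * ‖y‖ ^ 2 - t * (1 - t) * ‖x - y‖ ^ 2 := by
  rw [norm_add_sq_real, norm_sub_sq_real, norm_smul, norm_smul, real_inner_smul_left,
    real_inner_smul_right, mul_pow, mul_pow, Real.norm_eq_abs, Real.norm_eq_abs, sq_abs, sq_abs]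
  ring

theorem dist_sq_lineMap {E : Type*} [NormedAddCommGroup E] [InnerProductSpace ℝ E]
    (t : ℝ) (p q r : E) :
    dist p (AffineMap.lineMap q r t) ^ 2 =
      (1 - t) * dist p q ^ 2 + t * dist p r ^ 2 - t * (1 - t) * dist q r ^ 2 := by
  have e : p - AffineMap.lineMap q r t = (1 - t) • (p - q) + t • (p - r) := by
    rw [AffineMap.lineMap_apply_module]; module
  have e' : q - r = -((p - q) - (p - r)) := by abel
  rw [dist_eq_norm, dist_eq_norm, dist_eq_norm, dist_eq_norm, e, e', norm_neg,
    norm_sq_one_sub_smul_add_smul]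

theorem satisfiesCN_of_innerProductSpace (E : Type*) [NormedAddCommGroup E]
    [InnerProductSpace ℝ E] : SatisfiesCN E :=
  fun q r t _ => ⟨AffineMap.lineMap q r t, fun p => (dist_sq_lineMap t p q r).le⟩

theorem eq_lineMap_of_mem_segment {E : Type*} [NormedAddCommGroup E] [NormedSpace ℝ E]
    {a b p : E} {t : ℝ} (hp : p ∈ segment ℝ a b) (h : dist a p = t * dist a b) :
    p = AffineMap.lineMap a b t := by
  rw [segment_eq_image_lineMap] at hp
  obtain ⟨u, ⟨hu, -⟩, rfl⟩ := hp
  rw [dist_left_lineMap, Real.norm_of_nonneg hu] at h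
  rcases eq_or_ne a b with rfl | hab
  · simp
  · rw [mul_right_cancel₀ (dist_ne_zero.2 hab) h]

theorem IsGeodesicSegment.exists_ratio {X : Type*} [MetricSpace X] {a b p : X} {S : Set X}
    (hS : IsGeodesicSegment a b S) (hp : p ∈ S) :
    ∃ t ∈ Set.Icc (0 : ℝ) 1, dist a p = t * dist a b ∧ dist p b = (1 - t) * dist a b := by
  obtain ⟨γ, h0, h1, hγ, rfl⟩ := hS
  obtain ⟨s, hs, rfl⟩ := hp
  have hD : 0 ≤ dist a b := dist_nonneg
  have k₁ := hγ 0 ⟨le_rfl, hD⟩ s hs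
  have k₂ := hγ s hs (dist a b) ⟨hD, le_rfl⟩
  rw [h0, zero_sub, abs_neg, abs_of_nonneg hs.1] at k₁
  rw [h1, abs_sub_comm, abs_of_nonneg (sub_nonneg.2 hs.2)] at k₂
  rcases hD.eq_or_lt with h | h
  · refine ⟨0, by simp, ?_, ?_⟩
    · have := hs.1; have := hs.2; rw [k₁]; linarith
    · have := hs.1; have := hs.2; rw [k₂]; linarith
  · refine ⟨s / dist a b, ⟨div_nonneg hs.1 hD, (div_le_one h).2 hs.2⟩, ?_, ?_⟩
    · rw [k₁, div_mul_cancel₀ _ h.ne']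
    · rw [k₂, sub_mul, div_mul_cancel₀ _ h.ne', one_mul]

/-- Two points on two sides of a triangle are compared by applying the inequality to each side in
turn; in the Euclidean plane both inequalities are equalities. -/
theorem SatisfiesCN.isCAT0Space {X : Type*} [MetricSpace X] (h : SatisfiesCN X) :
    IsCAT0Space X := by
  constructor
  · intro x y
    obtain ⟨γ, h0, h1, hγ⟩ := h.exists_isometric_path x y
    exact ⟨_, γ, h0, h1, hγ, rfl⟩
  · intro a b c S₁ S₂ S₃ hS₁ hS₂ _ a' b' c' hab hac hbc p hp q hq p' hp' q' hq' hap haq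
    obtain ⟨s, hs, s₁, s₂⟩ := hS₁.exists_ratio hp
    obtain ⟨t, ht, t₁, t₂⟩ := hS₂.exists_ratio hq
    have ep := eq_lineMap_of_mem_segment hp' (hap.trans (s₁.trans (by rw [hab])))
    have eq := eq_lineMap_of_mem_segment hq' (haq.trans (t₁.trans (by rw [hac])))
    have k₁ := h.dist_sq_le hs s₁.le s₂.le q
    have k₂ := h.dist_sq_le ht t₁.le t₂.le b
    have l₁ := dist_sq_lineMap s q' a' b'
    have l₂ := dist_sq_lineMap t b' a' c'
    rw [← ep] at l₁
    rw [← eq] at l₂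
    rw [dist_comm q' p', dist_comm q' a', dist_comm q' b', haq, hab] at l₁
    rw [dist_comm b' a', hab, hbc, hac] at l₂
    rw [dist_comm q p, dist_comm q a, dist_comm q b] at k₁
    rw [dist_comm b a] at k₂
    have k₃ := mul_le_mul_of_nonneg_left k₂ hs.1
    refine (le_abs_self _).trans (abs_le_of_sq_le_sq ?_ dist_nonneg)
    rw [l₁, l₂]
    linarith

theorem withLp_dist_sq {X Y : Type*} [MetricSpace X] [MetricSpace Y] (x y : WithLp 2 (X × Y)) :
    dist x y ^ 2 = dist x.fst y.fst ^ 2 + dist x.snd y.snd ^ 2 := by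
  rw [WithLp.prod_dist_eq_add (by norm_num)]
  norm_num
  rw [← Real.sqrt_eq_rpow, Real.sq_sqrt (by positivity)]

theorem SatisfiesCN.withLp_prod {X Y : Type*} [MetricSpace X] [MetricSpace Y]
    (hX : SatisfiesCN X) (hY : SatisfiesCN Y) : SatisfiesCN (WithLp 2 (X × Y)) := by
  intro q r t ht
  obtain ⟨m, hm⟩ := hX q.fst r.fst t ht
  obtain ⟨n, hn⟩ := hY q.snd r.snd t ht
  refine ⟨WithLp.toLp 2 (m, n), fun p => ?_⟩
  have := hm p.fst
  have := hn p.snd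
  simp only [withLp_dist_sq]
  change dist p.fst m ^ 2 + dist p.snd n ^ 2 ≤ _
  linarith

/-- A 0-hyperbolic metric space, by Gromov's four point condition. -/
def IsZeroHyperbolic (X : Type*) [MetricSpace X] : Prop :=
  ∀ x y z w : X, dist x y + dist z w ≤ max (dist x z + dist y w) (dist x w + dist y z)

/-- In a 0-hyperbolic metric space a point between `q` and `r` satisfies the Bruhat–Tits
inequality. -/
theorem IsZeroHyperbolic.satisfiesCN {X : Type*} [MetricSpace X] (h4 : IsZeroHyperbolic X)
    (hm : ∀ q r : X, ∀ a b : ℝ, 0 ≤ a → 0 ≤ b → a + b = dist q r →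
      ∃ m, dist q m ≤ a ∧ dist m r ≤ b) : SatisfiesCN X := by
  intro q r t ht
  set D := dist q r with hD
  have hD0 : 0 ≤ D := dist_nonneg
  obtain ⟨m, m₁, m₂⟩ := hm q r (t * D) ((1 - t) * D) (mul_nonneg ht.1 hD0)
    (mul_nonneg (sub_nonneg.2 ht.2) hD0) (by ring)
  refine ⟨m, fun p => ?_⟩
  have k := h4 p m q r
  rw [← hD, dist_comm m q] at k
  have tri₁ := dist_triangle q p r
  have tri₂ := dist_triangle p q r
  have tri₃ := dist_triangle p r q
  rw [dist_comm q p, ← hD] at tri₁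
  rw [← hD] at tri₂
  rw [dist_comm r q, ← hD] at tri₃
  rcases le_max_iff.1 k with k | k
  · -- `d(p, m) ≤ d(p, q) - t D`, and `(d(p, q) - D)² ≤ d(p, r)²`
    have k₁ : dist p m ≤ dist p q - t * D := by linarith
    have k₂ : dist p m ^ 2 ≤ (dist p q - t * D) ^ 2 := by gcongr
    have k₃ : (dist p q - D) ^ 2 ≤ dist p r ^ 2 :=
      sq_le_sq' (by linarith) (by linarith)
    have := mul_le_mul_of_nonneg_left k₃ ht.1
    nlinarith
  · have k₁ : dist p m ≤ dist p r - (1 - t) * D := by linarith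
    have k₂ : dist p m ^ 2 ≤ (dist p r - (1 - t) * D) ^ 2 := by gcongr
    have k₃ : (dist p r - D) ^ 2 ≤ dist p q ^ 2 :=
      sq_le_sq' (by linarith) (by linarith)
    have := mul_le_mul_of_nonneg_left k₃ (sub_nonneg.2 ht.2)
    nlinarith

/-! ### The tight span of a 0-hyperbolic metric space -/

/-- The tight span of a metric space `V`: the functions `f` on `V` with `d(x, y) ≤ f x + f y`, such
that for every `x` equality holds for some `y`. This is the space of extremal functions where the
infimum `f x = inf {d(x, y) - f y}` is required to be attained. If `V` is the vertex
set of a tree, it is the geometric realization of the tree, a point `p` being identified with the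
function `d(p, ·)`. -/
@[ext]
structure TightSpan (V : Type*) [MetricSpace V] where
  /-- The distance from the point to the points of `V`. -/
  toFun : V → ℝ
  dist_le' : ∀ x y, dist x y ≤ toFun x + toFun y
  exists_eq' : ∀ x, ∃ y, toFun x + toFun y = dist x y

namespace TightSpan

variable {V : Type*} [MetricSpace V]

instance : CoeFun (TightSpan V) fun _ => V → ℝ := ⟨toFun⟩

theorem dist_le (f : TightSpan V) (x y : V) : dist x y ≤ f x + f y := f.dist_le' x y

theorem exists_eq (f : TightSpan V) (x : V) : ∃ y, f x + f y = dist x y := f.exists_eq' x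

theorem nonneg (f : TightSpan V) (x : V) : 0 ≤ f x := by
  have := f.dist_le x x
  rw [dist_self] at this
  linarith

theorem le_add_dist (f : TightSpan V) (x y : V) : f x ≤ f y + dist x y := by
  obtain ⟨z, hz⟩ := f.exists_eq x
  linarith [dist_triangle x y z, f.dist_le y z]

theorem sub_le_add (f g : TightSpan V) (x y : V) : f x - g x ≤ f y + g y := by
  linarith [f.le_add_dist x y, g.dist_le x y]

theorem bddAbove_abs_sub (f g : TightSpan V) : BddAbove (Set.range fun x => |f x - g x|) := by
  rcases isEmpty_or_nonempty V with h | ⟨⟨y⟩⟩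
  · simp
  refine ⟨f y + g y, ?_⟩
  rintro _ ⟨x, rfl⟩
  exact abs_le.2 ⟨by linarith [sub_le_add g f x y], sub_le_add f g x y⟩

noncomputable instance : Dist (TightSpan V) := ⟨fun f g => ⨆ x, |f x - g x|⟩

theorem abs_sub_le_dist (f g : TightSpan V) (x : V) : |f x - g x| ≤ dist f g :=
  le_ciSup (bddAbove_abs_sub f g) x

theorem sub_le_dist (f g : TightSpan V) (x : V) : f x - g x ≤ dist f g :=
  (le_abs_self _).trans (abs_sub_le_dist f g x)

noncomputable instance : MetricSpace (TightSpan V) where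
  dist_self f := by simp [dist]
  dist_comm f g := by simp only [dist, abs_sub_comm]
  dist_triangle f g h := by
    refine Real.iSup_le (fun x => ?_) (add_nonneg
      (Real.iSup_nonneg fun _ => abs_nonneg _) (Real.iSup_nonneg fun _ => abs_nonneg _))
    exact (abs_sub_le _ (g x) _).trans (add_le_add (abs_sub_le_dist f g x) (abs_sub_le_dist g h x))
  eq_of_dist_eq_zero {f g} h := by
    ext x
    have := abs_sub_le_dist f g x
    rw [h] at this
    exact sub_eq_zero.1 (abs_eq_zero.1 (le_antisymm this (abs_nonneg _)))

theorem le_add_add_dist (f g : TightSpan V) (x y : V) : dist x y ≤ f x + g y + dist f g := by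
  linarith [f.dist_le x y, sub_le_dist f g y]

/-- Together with `le_add_add_dist`, this says that the distance of `f` and `g` is the supremum of
`d(x, y) - f x - g y`. -/
theorem dist_le_of_forall_le [Nonempty V] {f g : TightSpan V} {c : ℝ}
    (h : ∀ x y, dist x y ≤ f x + g y + c) : dist f g ≤ c := by
  have h₁ : ∀ x, f x - g x ≤ c := fun x => by
    obtain ⟨y, hy⟩ := f.exists_eq x
    have := h y x
    rw [dist_comm] at this
    linarith
  have h₂ : ∀ x, g x - f x ≤ c := fun x => by
    obtain ⟨y, hy⟩ := g.exists_eq x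
    linarith [h x y]
  exact ciSup_le fun x => abs_le.2 ⟨by linarith [h₂ x], h₁ x⟩

theorem isZeroHyperbolic [Nonempty V] (hV : IsZeroHyperbolic V) :
    IsZeroHyperbolic (TightSpan V) := by
  intro f g h k
  rw [← le_sub_iff_add_le]
  refine dist_le_of_forall_le fun x y => ?_
  have : dist h k ≤ f x + g y - dist x y +
      max (dist f h + dist g k) (dist f k + dist g h) := by
    refine dist_le_of_forall_le fun z w => ?_
    have k₁ := le_add_add_dist f h x z
    have k₂ := le_add_add_dist g k y w
    have k₃ := le_add_add_dist f k x w
    have k₄ := le_add_add_dist g h y z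
    have k₅ := le_max_left (dist f h + dist g k) (dist f k + dist g h)
    have k₆ := le_max_right (dist f h + dist g k) (dist f k + dist g h)
    rcases le_max_iff.1 (hV x y z w) with k₀ | k₀ <;> linarith
  linarith

/-- The four point condition for two points of `V` and two points of the tight span. -/
theorem dist_add_dist_le [Nonempty V] (hV : IsZeroHyperbolic V) (f g : TightSpan V) (x y : V) :
    dist x y + dist f g ≤ max (f x + g y) (f y + g x) := by
  rw [add_comm, ← le_sub_iff_add_le]
  refine dist_le_of_forall_le fun z w => ?_
  have k₁ := f.dist_le x z
  have k₂ := g.dist_le y w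
  have k₃ := g.dist_le x w
  have k₄ := f.dist_le y z
  have k₅ := le_max_left (f x + g y) (f y + g x)
  have k₆ := le_max_right (f x + g y) (f y + g x)
  rcases le_max_iff.1 (hV x y z w) with k₀ | k₀ <;> linarith

theorem exists_sub_add_max_eq [Nonempty V] (hV : IsZeroHyperbolic V) {f g : TightSpan V} {a b : ℝ}
    (ha : 0 ≤ a) (hab : a + b = dist f g) {x : V} (hx : g x - b ≤ f x - a) :
    ∃ y, f x - a + max (f y - a) (g y - b) = dist x y := by
  obtain ⟨y, hy⟩ := f.exists_eq x
  refine ⟨y, ?_⟩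
  have hg := sub_le_dist g f y
  rw [dist_comm] at hg
  rcases ha.eq_or_lt with rfl | ha
  · rw [max_eq_left (by linarith)]
    linarith
  · -- Since the path from `x` to `g` passes through `f`, so does the path from `y` to `g`.
    have k : f y + dist f g ≤ g y := by
      rcases le_max_iff.1 (dist_add_dist_le hV f g x y) with k | k <;> linarith
    rw [max_eq_right (by linarith)]
    linarith

/-- The point at distances `a` and `b` from `f` and `g` is the function `max (f - a) (g - b)`. -/
theorem exists_dist_le [Nonempty V] (hV : IsZeroHyperbolic V) (f g : TightSpan V) (a b : ℝ)
    (ha : 0 ≤ a) (hb : 0 ≤ b) (hab : a + b = dist f g) :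
    ∃ m, dist f m ≤ a ∧ dist m g ≤ b := by
  let m : TightSpan V :=
    { toFun := fun x => max (f x - a) (g x - b)
      dist_le' := fun x y => by
        have k₁ := le_max_left (f x - a) (g x - b)
        have k₂ := le_max_right (f x - a) (g x - b)
        have k₃ := le_max_left (f y - a) (g y - b)
        have k₄ := le_max_right (f y - a) (g y - b)
        rcases le_max_iff.1 (dist_add_dist_le hV f g x y) with k | k <;> linarith
      exists_eq' := fun x => by
        rcases le_total (g x - b) (f x - a) with h | h
        · simp only [max_eq_left h]
          exact exists_sub_add_max_eq hV ha hab h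
        · simp only [max_eq_right h]
          obtain ⟨y, hy⟩ :=
            exists_sub_add_max_eq hV hb (by rw [dist_comm, ← hab, add_comm]) h
          exact ⟨y, by rw [max_comm (f y - a), hy]⟩ }
  refine ⟨m, dist_le_of_forall_le fun x y => ?_, dist_le_of_forall_le fun x y => ?_⟩
  · have := le_max_left (f y - a) (g y - b)
    change _ ≤ f x + max (f y - a) (g y - b) + a
    linarith [f.dist_le x y]
  · have := le_max_right (f x - a) (g x - b)
    change _ ≤ max (f x - a) (g x - b) + g y + b
    linarith [g.dist_le x y]

theorem satisfiesCN [Nonempty V] (hV : IsZeroHyperbolic V) : SatisfiesCN (TightSpan V) :=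
  (isZeroHyperbolic hV).satisfiesCN (exists_dist_le hV)

/-- The point of the tight span given by a point of `V`. -/
def vertex (v : V) : TightSpan V where
  toFun := dist v
  dist_le' := fun x y => dist_triangle_left x y v
  exists_eq' x := ⟨v, by rw [dist_self, add_zero, dist_comm]⟩

theorem dist_vertex (v : V) (f : TightSpan V) : dist (vertex v) f = f v := by
  have : Nonempty V := ⟨v⟩
  apply le_antisymm
  · refine dist_le_of_forall_le fun x y => ?_
    change dist x y ≤ dist v x + f y + f v
    linarith [dist_triangle_left x y v, f.dist_le v y]
  · have := sub_le_dist f (vertex v) v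
    change f v - dist v v ≤ _ at this
    rw [dist_self, sub_zero, dist_comm] at this
    exact this

instance : MulAction (V ≃ᵢ V) (TightSpan V) where
  smul e f :=
    { toFun := fun x => f (e.symm x)
      dist_le' := fun x y => by
        rw [← e.symm.dist_eq]
        exact f.dist_le _ _
      exists_eq' := fun x => by
        obtain ⟨y, hy⟩ := f.exists_eq (e.symm x)
        refine ⟨e y, ?_⟩
        rw [e.symm_apply_apply, hy, ← e.dist_eq, e.apply_symm_apply] }
  one_smul _ := rfl
  mul_smul _ _ _ := rfl

theorem smul_apply (e : V ≃ᵢ V) (f : TightSpan V) (x : V) : (e • f) x = f (e.symm x) := rfl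

theorem smul_vertex (e : V ≃ᵢ V) (v : V) : e • vertex v = vertex (e v) := by
  ext x
  change dist v (e.symm x) = dist (e v) x
  rw [← e.dist_eq, e.apply_symm_apply]

theorem dist_smul (e : V ≃ᵢ V) (f g : TightSpan V) : dist (e • f) (e • g) = dist f g :=
  e.symm.toEquiv.iSup_congr fun _ => rfl

theorem dist_smul_vertex_le (e : V ≃ᵢ V) (v : V) (f : TightSpan V) :
    dist (e v) v ≤ dist (e • f) f + 2 * f v := by
  have h₁ : dist (e • f) (vertex (e v)) = f v := by
    rw [← smul_vertex, dist_smul, dist_comm, dist_vertex]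
  have h₂ := sub_le_dist f (e • f) (e v)
  rw [dist_comm] at h₁ h₂
  rw [dist_vertex] at h₁
  linarith [f.dist_le (e v) v]

end TightSpan

/-! ### The word metric of a free group -/

/-- The length of the longest common prefix of two lists. -/
def List.commonPrefixLength {β : Type*} [DecidableEq β] : List β → List β → ℕ
  | a :: l, b :: m => if a = b then l.commonPrefixLength m + 1 else 0
  | [], _ => 0
  | _ :: _, [] => 0

theorem List.min_commonPrefixLength_le {β : Type*} [DecidableEq β] (l m n : List β) :
    min (l.commonPrefixLength m) (m.commonPrefixLength n) ≤ l.commonPrefixLength n := by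
  induction l generalizing m n with
  | nil => simp [commonPrefixLength]
  | cons a l ih =>
    cases m with
    | nil => simp [commonPrefixLength]
    | cons b m =>
      cases n with
      | nil => simp [commonPrefixLength]
      | cons c n =>
        have := ih m n
        simp only [commonPrefixLength]
        split_ifs <;> first | omega | simp_all

namespace FreeGroup

variable {α : Type*}

/-- The endomorphism which raises each free generator to the power `1` or `-1`. -/
def signHom (s : α → ℤˣ) : FreeGroup α →* FreeGroup α := lift fun a => of a ^ (s a : ℤ)

@[simp]
theorem signHom_of (s : α → ℤˣ) (a : α) : signHom s (of a) = of a ^ (s a : ℤ) := by simp [signHom]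

theorem signHom_signHom (s t : α → ℤˣ) (w : FreeGroup α) :
    signHom s (signHom t w) = signHom (s * t) w := by
  have : (signHom s).comp (signHom t) = signHom (s * t) := by
    ext a
    simp [← zpow_mul]
  exact DFunLike.congr_fun this w

theorem signHom_one (w : FreeGroup α) : signHom 1 w = w := by
  have : signHom (1 : α → ℤˣ) = MonoidHom.id _ := by
    ext a
    simp
  exact DFunLike.congr_fun this w

variable [DecidableEq α]

theorem IsReduced.invRev_append {L M : List (α × Bool)} (hL : IsReduced L) (hM : IsReduced M)
    (h : ∀ a ∈ L.head?, ∀ b ∈ M.head?, a ≠ b) : IsReduced (invRev L ++ M) := by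
  have hL' : IsReduced (invRev L) := by
    rw [isReduced_iff_reduce_eq] at hL ⊢
    rw [reduce_invRev, hL]
  refine List.isChain_append.2 ⟨hL', hM, ?_⟩
  intro x hx y hy hxy
  cases L with
  | nil => simp [invRev] at hx
  | cons a L =>
    have hxa : x = (a.1, !a.2) := by simpa [invRev, eq_comm] using hx
    have hne := h a rfl y hy
    subst hxa
    by_contra hcon
    refine hne (Prod.ext hxy ?_)
    cases h₁ : a.2 <;> cases h₂ : y.2 <;> simp_all

theorem norm_inv_mul_mk_add {L M : List (α × Bool)} (hL : IsReduced L) (hM : IsReduced M) :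
    norm ((mk L)⁻¹ * mk M) + 2 * L.commonPrefixLength M = L.length + M.length := by
  have key : ∀ {L M : List (α × Bool)}, IsReduced L → IsReduced M →
      (∀ a ∈ L.head?, ∀ b ∈ M.head?, a ≠ b) →
      norm ((mk L)⁻¹ * mk M) = L.length + M.length := by
    intro L M hL hM h
    rw [inv_mk, mul_mk, norm, toWord_mk, (hL.invRev_append hM h).reduce_eq, List.length_append,
      invRev_length]
  induction L generalizing M with
  | nil => rw [key hL hM (by simp)]; simp [List.commonPrefixLength]
  | cons a L ih =>
    cases M with
    | nil => rw [key hL hM (by simp)]; simp [List.commonPrefixLength]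
    | cons b M =>
      by_cases hab : a = b
      · subst hab
        have := ih (M := M) (hL.infix ⟨[a], [], by simp⟩) (hM.infix ⟨[a], [], by simp⟩)
        have e : (mk (a :: L))⁻¹ * mk (a :: M) = (mk L)⁻¹ * mk M := by
          rw [← List.singleton_append, ← List.singleton_append (l := M), ← mul_mk, ← mul_mk]
          group
        rw [e]
        simp only [List.commonPrefixLength, if_true, List.length_cons]
        omega
      · rw [key hL hM (by simpa using hab)]
        simp [List.commonPrefixLength, hab]

theorem norm_inv_mul_add (u v : FreeGroup α) :
    norm (u⁻¹ * v) + 2 * u.toWord.commonPrefixLength v.toWord = norm u + norm v := by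
  have := norm_inv_mul_mk_add (isReduced_toWord (x := u)) (isReduced_toWord (x := v))
  rwa [mk_toWord, mk_toWord] at this

/-- The word metric for the free generators. -/
noncomputable instance : MetricSpace (FreeGroup α) where
  dist u v := norm (u⁻¹ * v)
  dist_self u := by simp
  dist_comm u v := by rw [← norm_inv_eq]; simp
  dist_triangle u v w := by
    have := norm_mul_le (u⁻¹ * v) (v⁻¹ * w)
    rw [show u⁻¹ * v * (v⁻¹ * w) = u⁻¹ * w by group] at this
    exact_mod_cast this
  eq_of_dist_eq_zero {u v} h := by
    change (norm (u⁻¹ * v) : ℝ) = 0 at h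
    exact inv_mul_eq_one.1 (norm_eq_zero.1 (Nat.cast_eq_zero.1 h))

theorem dist_def (u v : FreeGroup α) : dist u v = norm (u⁻¹ * v) := rfl

theorem dist_one_left (u : FreeGroup α) : dist 1 u = norm u := by simp [dist_def]

theorem dist_mul_left (w u v : FreeGroup α) : dist (w * u) (w * v) = dist u v := by
  simp [dist_def, mul_assoc]

/-- Seen from a base point, twice the Gromov product of two elements is determined by the longest
common prefix of reduced words, whose length satisfies the ultrametric inequality. -/
theorem isZeroHyperbolic : IsZeroHyperbolic (FreeGroup α) := by
  have key : ∀ x y z : FreeGroup α, norm (x⁻¹ * y) + norm z ≤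
      max (norm (x⁻¹ * z) + norm y) (norm x + norm (y⁻¹ * z)) := by
    intro x y z
    have h₁ := norm_inv_mul_add x y
    have h₂ := norm_inv_mul_add x z
    have h₃ := norm_inv_mul_add z y
    have h₄ := List.min_commonPrefixLength_le x.toWord z.toWord y.toWord
    rw [← norm_inv_eq (x := z⁻¹ * y), mul_inv_rev, inv_inv] at h₃
    omega
  intro x y z w
  have h := key (w⁻¹ * x) (w⁻¹ * y) (w⁻¹ * z)
  have e : ∀ u v : FreeGroup α, (w⁻¹ * u)⁻¹ * (w⁻¹ * v) = u⁻¹ * v := fun u v => by group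
  rw [e, e, e] at h
  rw [dist_comm z w, dist_comm y w, dist_comm x w]
  simp only [dist_def]
  exact_mod_cast h

theorem exists_dist_le_of_le (y : FreeGroup α) {i : ℕ} (hi : i ≤ norm y) :
    ∃ z : FreeGroup α, dist 1 z ≤ i ∧ dist z y ≤ norm y - i := by
  refine ⟨mk (y.toWord.take i), ?_, ?_⟩
  · rw [dist_one_left]
    exact_mod_cast norm_mk_le.trans (by simp)
  · have e : (mk (y.toWord.take i))⁻¹ * y = mk (y.toWord.drop i) := by
      rw [inv_mul_eq_iff_eq_mul, mul_mk, List.take_append_drop, mk_toWord]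
    rw [dist_def, e, ← Nat.cast_sub hi]
    exact_mod_cast norm_mk_le.trans (by simp [norm])

theorem finite_setOf_norm_le [Finite α] (n : ℕ) : {u : FreeGroup α | norm u ≤ n}.Finite :=
  (List.finite_length_le (α × Bool) n).preimage toWord_injective.injOn

theorem norm_signHom_le (s : α → ℤˣ) (w : FreeGroup α) : norm (signHom s w) ≤ norm w := by
  have h : ∀ L : List (α × Bool), norm (signHom s (mk L)) ≤ L.length := by
    intro L
    induction L with
    | nil => simp [← one_eq_mk]
    | cons a L ih =>
      have ha : norm (signHom s (mk [a])) ≤ 1 := by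
        obtain ⟨a, b⟩ := a
        rcases Int.units_eq_one_or (s a) with hs | hs <;> cases b <;> simp [signHom, hs]
      rw [← List.singleton_append, ← mul_mk, _root_.map_mul]
      refine (norm_mul_le _ _).trans ?_
      simp only [List.length_append, List.length_singleton]
      omega
  have := h w.toWord
  rwa [mk_toWord] at this

theorem norm_signHom (s : α → ℤˣ) (w : FreeGroup α) : norm (signHom s w) = norm w := by
  refine le_antisymm (norm_signHom_le s w) ?_
  have := norm_signHom_le s (signHom s w)
  rwa [signHom_signHom, show s * s = 1 from funext fun a => Int.units_mul_self _,
    signHom_one] at this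

/-- The action of a free group on itself by left multiplication, as isometries of the word
metric. -/
noncomputable def mulLeftIsometry : FreeGroup α →* (FreeGroup α ≃ᵢ FreeGroup α) where
  toFun w := ⟨Equiv.mulLeft w, Isometry.of_dist_eq (dist_mul_left w)⟩
  map_one' := IsometryEquiv.ext fun u => one_mul u
  map_mul' v w := IsometryEquiv.ext fun u => mul_assoc v w u

/-- The automorphisms `signHom s` as isometries of the word metric. -/
noncomputable def signIsometry : (α → ℤˣ) →* (FreeGroup α ≃ᵢ FreeGroup α) where
  toFun s :=
    ⟨⟨signHom s, signHom s⁻¹, fun w => by rw [signHom_signHom, inv_mul_cancel, signHom_one],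
        fun w => by rw [signHom_signHom, mul_inv_cancel, signHom_one]⟩,
      Isometry.of_dist_eq fun u v => by
        change dist (signHom s u) (signHom s v) = _
        rw [dist_def, dist_def, ← _root_.map_inv, ← _root_.map_mul, norm_signHom]⟩
  map_one' := IsometryEquiv.ext fun u => signHom_one u
  map_mul' s t := IsometryEquiv.ext fun u => (signHom_signHom s t u).symm

theorem mulLeftIsometry_apply (w u : FreeGroup α) : mulLeftIsometry w u = w * u := rfl

theorem signIsometry_apply (s : α → ℤˣ) (u : FreeGroup α) : signIsometry s u = signHom s u := rfl

theorem signIsometry_mul_mulLeftIsometry (s : α → ℤˣ) (w : FreeGroup α) :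
    signIsometry s * mulLeftIsometry w = mulLeftIsometry (signHom s w) * signIsometry s :=
  IsometryEquiv.ext fun u => _root_.map_mul (signHom s) w u

end FreeGroup

namespace TightSpan

variable {α : Type*} [DecidableEq α]

theorem apply_le_max (f : TightSpan (FreeGroup α)) {y z : FreeGroup α} {i : ℝ}
    (hy : f 1 + f y = dist 1 y) (h₁ : dist 1 z ≤ i) (h₂ : dist z y ≤ dist 1 y - i) :
    f z ≤ max (f 1 - i) (i - f 1) := by
  have k := dist_add_dist_le FreeGroup.isZeroHyperbolic f (vertex z) 1 y
  rw [dist_comm f, dist_vertex] at k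
  change dist 1 y + f z ≤ max (f 1 + dist z y) (f y + dist z 1) at k
  rw [dist_comm z 1] at k
  rcases le_max_iff.1 k with k | k
  · exact le_max_of_le_left (by linarith)
  · exact le_max_of_le_right (by linarith)

/-- Every point of the tree is at distance at most one from a vertex. -/
theorem exists_apply_le_one (f : TightSpan (FreeGroup α)) : ∃ v, f v ≤ 1 := by
  obtain ⟨y, hy⟩ := f.exists_eq 1
  have hf := f.nonneg 1
  have hn : f 1 ≤ FreeGroup.norm y := by
    rw [← FreeGroup.dist_one_left, ← hy]
    linarith [f.nonneg y]
  have hi₀ := Nat.floor_le hf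
  have hi₁ := Nat.lt_floor_add_one (f 1)
  obtain ⟨z, h₁, h₂⟩ := FreeGroup.exists_dist_le_of_le y
    (i := ⌊f 1⌋₊) (by exact_mod_cast hi₀.trans hn)
  rw [← FreeGroup.dist_one_left] at h₂
  exact ⟨z, (f.apply_le_max hy h₁ h₂).trans (max_le (by linarith) (by linarith))⟩

/-- A point of the tree at distance at most one from the vertex `1` lies on an edge at `1`. -/
theorem exists_apply_one_add_apply_le (f : TightSpan (FreeGroup α)) (hf : f 1 ≤ 1) :
    ∃ v, FreeGroup.norm v ≤ 1 ∧ f 1 + f v ≤ dist 1 v := by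
  obtain ⟨y, hy⟩ := f.exists_eq 1
  rcases Nat.eq_zero_or_pos (FreeGroup.norm y) with h0 | hpos
  · exact ⟨y, by omega, hy.le⟩
  obtain ⟨z, h₁, h₂⟩ := FreeGroup.exists_dist_le_of_le y (i := 1) hpos
  rw [← FreeGroup.dist_one_left] at h₂
  have hz := f.apply_le_max hy h₁ h₂
  rw [Nat.cast_one] at h₁ h₂ hz
  rw [max_eq_right (by linarith)] at hz
  refine ⟨z, ?_, ?_⟩
  · rw [FreeGroup.dist_one_left] at h₁
    exact_mod_cast h₁
  · linarith [dist_triangle 1 z y]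

theorem exists_isCompact [Finite α] :
    ∃ K : Set (TightSpan (FreeGroup α)), IsCompact K ∧ ∀ f, f 1 ≤ 1 → f ∈ K := by
  choose K hK hmem using fun v : FreeGroup α =>
    (satisfiesCN FreeGroup.isZeroHyperbolic).exists_isCompact_of_dist_add_dist_le
      (vertex 1) (vertex v)
  refine ⟨_, (FreeGroup.finite_setOf_norm_le 1).isCompact_biUnion fun v _ => hK v,
    fun f hf => ?_⟩
  obtain ⟨v, hv, hfv⟩ := f.exists_apply_one_add_apply_le hf
  refine Set.mem_biUnion hv (hmem v f ?_)
  rw [dist_vertex, dist_comm f, dist_vertex, dist_vertex]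
  change _ ≤ dist v 1
  rwa [dist_comm v 1]

end TightSpan

/-! ### The universal property of the group -/

/-- The relations of the group in terms of `a₁ = x₁`, `a₂ = x₂`, `s = t₁` and `z = ξ`: the elements
`s` and `z` commute and act on `a₁` and `a₂` by changes of signs. -/
structure SignRelations (ε δ : ℤˣ) {P : Type*} [Group P] (a₁ a₂ s z : P) : Prop where
  s_mul_a₁ : s * a₁ = a₁⁻¹ * s
  s_mul_a₂ : s * a₂ = a₂ * s
  s_mul_s : s * s = 1
  s_mul_z : s * z = z * s
  z_mul_a₁ : z * a₁ = a₁ ^ (ε : ℤ) * z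
  z_mul_a₂ : z * a₂ = a₂ ^ (δ : ℤ) * z

/-- `G` is the semidirect product of the free group on `x₁`, `x₂` by `⟨ξ⟩ × ⟨t⟩ ≅ ℤ × ℤ/2`, where
`t` and `ξ` act by changes of signs. This is expressed by the relations, the existence (but not the
uniqueness) of normal forms, and the universal property. -/
structure IsSignExtension (ε δ : ℤˣ) {G : Type} [Group G] (x₁ x₂ t ξ : G) : Prop where
  rel : SignRelations ε δ x₁ x₂ t ξ
  exists_eq : ∀ g : G, ∃ (w : FreeGroup (Fin 2)) (n : ℤ) (i : ZMod 2),
    g = FreeGroup.lift ![x₁, x₂] w * ξ ^ n * t ^ i.val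
  exists_hom : ∀ {P : Type} [Group P] {a₁ a₂ s z : P}, SignRelations ε δ a₁ a₂ s z →
    ∃ f : G →* P, f x₁ = a₁ ∧ f x₂ = a₂ ∧ f t = s ∧ f ξ = z

/-- The homomorphism from `ℤ/2` given by an element `s` with `s² = 1`. -/
def zmodTwoHom {P : Type*} [Group P] (s : P) (hs : s * s = 1) :
    Multiplicative (ZMod 2) →* P where
  toFun i := s ^ i.toAdd.val
  map_one' := by simp
  map_mul' i j := by
    rw [toAdd_mul, ZMod.val_add, ← pow_eq_pow_mod _ (by rw [pow_two, hs]), pow_add]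

theorem zmodTwoHom_apply {P : Type*} [Group P] (s : P) (hs : s * s = 1)
    (i : Multiplicative (ZMod 2)) : zmodTwoHom s hs i = s ^ i.toAdd.val := rfl

@[simp]
theorem zmodTwoHom_ofAdd_one {P : Type*} [Group P] (s : P) (hs : s * s = 1) :
    zmodTwoHom s hs (Multiplicative.ofAdd 1) = s := by
  rw [zmodTwoHom_apply, toAdd_ofAdd, ZMod.val_one, pow_one]

theorem ofAdd_one_pow_val (i : Multiplicative (ZMod 2)) :
    Multiplicative.ofAdd (1 : ZMod 2) ^ i.toAdd.val = i := by
  change ZMod 2 at i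
  fin_cases i <;> rfl

/-- Compatibility of two homomorphisms on the factors of a semidirect product only has to be
checked on generators of the acting group. -/
theorem SemidirectProduct.comp_eq_conj_comp_of_closure {N H P : Type*} [Group N] [Group H] [Group P]
    {φ : H →* MulAut N} {f₁ : N →* P} {f₂ : H →* P} {S : Set H} (hS : Subgroup.closure S = ⊤)
    (h : ∀ g ∈ S, f₁.comp (φ g).toMonoidHom = (MulAut.conj (f₂ g)).toMonoidHom.comp f₁) (g : H) :
    f₁.comp (φ g).toMonoidHom = (MulAut.conj (f₂ g)).toMonoidHom.comp f₁ := by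
  have hg : g ∈ Subgroup.closure S := hS ▸ Subgroup.mem_top g
  induction hg using Subgroup.closure_induction with
  | mem g hg => exact h g hg
  | one => ext; simp
  | mul g g' _ _ ih ih' =>
    ext n
    have e := DFunLike.congr_fun ih (φ g' n)
    have e' := DFunLike.congr_fun ih' n
    simp only [MonoidHom.comp_apply, MulEquiv.coe_toMonoidHom, MulAut.conj_apply] at e e' ⊢
    rw [map_mul, MulAut.mul_apply, e, e', map_mul]
    group
  | inv g _ ih =>
    ext n
    have e := DFunLike.congr_fun ih (φ g⁻¹ n)
    simp only [MonoidHom.comp_apply, MulEquiv.coe_toMonoidHom, MulAut.conj_apply] at e ⊢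
    rw [← MulAut.mul_apply, ← map_mul, mul_inv_cancel, map_one, MulAut.one_apply] at e
    rw [e, map_inv f₂]
    group

theorem closure_prod_zmodTwo :
    Subgroup.closure {((Multiplicative.ofAdd 1, 1) : Multiplicative ℤ × Multiplicative (ZMod 2)),
      (1, Multiplicative.ofAdd 1)} = ⊤ := by
  rw [eq_top_iff]
  rintro ⟨n, i⟩ -
  have e : (n, i) = ((Multiplicative.ofAdd 1, 1) : Multiplicative ℤ × Multiplicative (ZMod 2)) ^
      n.toAdd * (1, Multiplicative.ofAdd 1) ^ i.toAdd.val := by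
    ext
    · simp [← ofAdd_zsmul]
    · simp [ofAdd_one_pow_val]
  rw [e]
  exact mul_mem (zpow_mem (Subgroup.subset_closure (by simp)) _)
    (pow_mem (Subgroup.subset_closure (by simp)) _)

theorem SignRelations.commute_z_s {ε δ : ℤˣ} {P : Type*} [Group P] {a₁ a₂ s z : P}
    (h : SignRelations ε δ a₁ a₂ s z) : Commute z s := h.s_mul_z.symm

/-- With `ξ = x₂⁻ᵏ t₂` the group has the presentation by `SignRelations`. -/
theorem isSignExtension_semidirectProduct (k : ℤ) (ε δ : ℤˣ)
    (φ : Multiplicative ℤ × Multiplicative (ZMod 2) →* MulAut (FreeGroup (Fin 2)))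
    (h₁₁ : φ (1, Multiplicative.ofAdd 1) (FreeGroup.of 0) = (FreeGroup.of 0)⁻¹)
    (h₁₂ : φ (1, Multiplicative.ofAdd 1) (FreeGroup.of 1) = FreeGroup.of 1)
    (h₂₁ : φ (Multiplicative.ofAdd 1, 1) (FreeGroup.of 0) =
      FreeGroup.of 1 ^ k * FreeGroup.of 0 ^ (ε : ℤ) * FreeGroup.of 1 ^ (-k))
    (h₂₂ : φ (Multiplicative.ofAdd 1, 1) (FreeGroup.of 1) = FreeGroup.of 1 ^ (δ : ℤ)) :
    IsSignExtension ε δ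
      (SemidirectProduct.inl (FreeGroup.of 0) :
        FreeGroup (Fin 2) ⋊[φ] (Multiplicative ℤ × Multiplicative (ZMod 2)))
      (SemidirectProduct.inl (FreeGroup.of 1))
      (SemidirectProduct.inr (1, Multiplicative.ofAdd 1))
      ((SemidirectProduct.inl (FreeGroup.of 1)) ^ (-k) *
        SemidirectProduct.inr (Multiplicative.ofAdd 1, 1)) := by
  set x₁ : FreeGroup (Fin 2) ⋊[φ] _ := SemidirectProduct.inl (FreeGroup.of 0) with hx₁
  set x₂ : FreeGroup (Fin 2) ⋊[φ] _ := SemidirectProduct.inl (FreeGroup.of 1) with hx₂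
  set t₁ : FreeGroup (Fin 2) ⋊[φ] _ := SemidirectProduct.inr (1, Multiplicative.ofAdd 1) with ht₁
  set t₂ : FreeGroup (Fin 2) ⋊[φ] _ := SemidirectProduct.inr (Multiplicative.ofAdd 1, 1) with ht₂
  have hinr : ∀ (h : Multiplicative ℤ × Multiplicative (ZMod 2)) (w : FreeGroup (Fin 2)),
      SemidirectProduct.inr h * SemidirectProduct.inl w = SemidirectProduct.inl (φ h w) * (SemidirectProduct.inr h :
        FreeGroup (Fin 2) ⋊[φ] _) := fun h w => by
    rw [SemidirectProduct.inl_aut, mul_assoc, ← map_mul, inv_mul_cancel, map_one, mul_one]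
  have r₁₁ : t₁ * x₁ = x₁⁻¹ * t₁ := by rw [hinr, h₁₁, map_inv]
  have r₁₂ : t₁ * x₂ = x₂ * t₁ := by rw [hinr, h₁₂]
  have r₂₁ : t₂ * x₁ = x₂ ^ k * x₁ ^ (ε : ℤ) * x₂ ^ (-k) * t₂ := by
    rw [hinr, h₂₁, map_mul, map_mul, map_zpow, map_zpow, map_zpow]
  have r₂₂ : t₂ * x₂ = x₂ ^ (δ : ℤ) * t₂ := by rw [hinr, h₂₂, map_zpow]
  have r₁₁' : t₁ * t₁ = 1 := by
    rw [ht₁, ← map_mul]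
    exact map_one _
  have r₁₂' : t₁ * t₂ = t₂ * t₁ := by
    rw [ht₁, ht₂, ← map_mul, ← map_mul, mul_comm]
  have hc : Commute t₁ (x₂ ^ (-k)) := Commute.zpow_right r₁₂ _
  constructor
  · constructor
    · exact r₁₁
    · exact r₁₂
    · exact r₁₁'
    · exact hc.mul_right r₁₂'
    · rw [mul_assoc, r₂₁]; group
    · rw [mul_assoc, r₂₂]; group
  · intro g
    -- `g` and `ξⁿ t₁ⁱ` have the same image in `ℤ × ℤ/2`, so that their quotient lies in the free
    -- group.
    set ξ := x₂ ^ (-k) * t₂ with hξ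
    have hright : (g * (ξ ^ g.right.1.toAdd * t₁ ^ g.right.2.toAdd.val)⁻¹).right = 1 := by
      have e₁ : SemidirectProduct.rightHom ξ = (Multiplicative.ofAdd 1, 1) := by
        rw [hξ, map_mul, map_zpow, hx₂, ht₂]
        simp
      have e₂ : SemidirectProduct.rightHom t₁ = (1, Multiplicative.ofAdd 1) := by
        rw [ht₁]; simp
      rw [← SemidirectProduct.rightHom_eq_right,
        map_mul, map_inv, map_mul, map_zpow, map_pow, e₁, e₂, mul_inv_eq_one]
      ext
      · simp [← ofAdd_zsmul]
      · simp [ofAdd_one_pow_val]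
    refine ⟨(g * (ξ ^ g.right.1.toAdd * t₁ ^ g.right.2.toAdd.val)⁻¹).left, g.right.1.toAdd,
      g.right.2.toAdd, ?_⟩
    have e : FreeGroup.lift ![x₁, x₂] = SemidirectProduct.inl := by
      refine FreeGroup.ext_hom _ _ fun i => ?_
      fin_cases i <;> simp [hx₁, hx₂]
    have e' := SemidirectProduct.inl_left_mul_inr_right
      (g * (ξ ^ g.right.1.toAdd * t₁ ^ g.right.2.toAdd.val)⁻¹)
    rw [hright, map_one, mul_one] at e'
    rw [e, e']
    group
  · intro P _ a₁ a₂ s z h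
    have hcomm : Commute (a₂ ^ k * z) s :=
      (Commute.zpow_left h.s_mul_a₂.symm k).mul_left h.commute_z_s
    let f₁ : FreeGroup (Fin 2) →* P := FreeGroup.lift ![a₁, a₂]
    let f₂ : Multiplicative ℤ × Multiplicative (ZMod 2) →* P :=
      (zpowersHom P (a₂ ^ k * z)).noncommCoprod (zmodTwoHom s h.s_mul_s)
      fun n i => by
        rw [zpowersHom_apply, zmodTwoHom_apply]
        exact (hcomm.zpow_left _).pow_right _
    have e₁ : f₂ (Multiplicative.ofAdd 1, 1) = a₂ ^ k * z := by
      simp [f₂]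
    have e₂ : f₂ (1, Multiplicative.ofAdd 1) = s := by
      simp [f₂]
    have hcompat := SemidirectProduct.comp_eq_conj_comp_of_closure (φ := φ) (f₁ := f₁) (f₂ := f₂)
      closure_prod_zmodTwo (by
        rintro g (rfl | rfl)
        · ext i
          fin_cases i
          · simp only [MonoidHom.comp_apply, MulEquiv.coe_toMonoidHom, MulAut.conj_apply, e₁]
            change f₁ (φ (Multiplicative.ofAdd 1, 1) (FreeGroup.of 0)) = _ * f₁ (FreeGroup.of 0) * _
            rw [h₂₁]
            simp only [map_mul, map_zpow, f₁, FreeGroup.lift_apply_of, Matrix.cons_val_zero,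
              Matrix.cons_val_one,
              Matrix.cons_val_fin_one]
            rw [mul_assoc (a₂ ^ k) z, h.z_mul_a₁]
            group
          · simp only [MonoidHom.comp_apply, MulEquiv.coe_toMonoidHom, MulAut.conj_apply, e₁]
            change f₁ (φ (Multiplicative.ofAdd 1, 1) (FreeGroup.of 1)) = _ * f₁ (FreeGroup.of 1) * _
            rw [h₂₂]
            simp only [map_zpow, f₁, FreeGroup.lift_apply_of, Matrix.cons_val_one,
              Matrix.cons_val_fin_one]
            rw [mul_assoc (a₂ ^ k) z, h.z_mul_a₂]
            group
        · ext i
          fin_cases i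
          · simp only [MonoidHom.comp_apply, MulEquiv.coe_toMonoidHom, MulAut.conj_apply, e₂]
            change f₁ (φ (1, Multiplicative.ofAdd 1) (FreeGroup.of 0)) = _ * f₁ (FreeGroup.of 0) * _
            rw [h₁₁]
            simp only [map_inv, f₁, FreeGroup.lift_apply_of, Matrix.cons_val_zero]
            rw [h.s_mul_a₁]
            group
          · simp only [MonoidHom.comp_apply, MulEquiv.coe_toMonoidHom, MulAut.conj_apply, e₂]
            change f₁ (φ (1, Multiplicative.ofAdd 1) (FreeGroup.of 1)) = _ * f₁ (FreeGroup.of 1) * _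
            rw [h₁₂]
            simp only [f₁, FreeGroup.lift_apply_of, Matrix.cons_val_one,
              Matrix.cons_val_fin_one]
            rw [h.s_mul_a₂]
            group)
    refine ⟨SemidirectProduct.lift f₁ f₂ hcompat, ?_, ?_, ?_, ?_⟩
    · simp [hx₁, f₁]
    · simp [hx₂, f₁]
    · rw [ht₁, SemidirectProduct.lift_inr, e₂]
    · rw [map_mul, map_zpow, hx₂, ht₂, SemidirectProduct.lift_inr, SemidirectProduct.lift_inl, e₁]
      simp [f₁]

/-! ### The action on the product of the tree and the line -/

namespace IsSignExtension

variable {ε δ : ℤˣ} {G : Type} [Group G] {x₁ x₂ t ξ : G}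

theorem exists_isometry_hom (h : IsSignExtension ε δ x₁ x₂ t ξ) :
    ∃ α : G →* (FreeGroup (Fin 2) ≃ᵢ FreeGroup (Fin 2)),
      ∀ (w : FreeGroup (Fin 2)) (n : ℤ) (i : ℕ),
        α (FreeGroup.lift ![x₁, x₂] w * ξ ^ n * t ^ i) 1 = w := by
  have rel : SignRelations ε δ (FreeGroup.mulLeftIsometry (FreeGroup.of (0 : Fin 2)))
      (FreeGroup.mulLeftIsometry (FreeGroup.of 1)) (FreeGroup.signIsometry ![-1, 1])
      (FreeGroup.signIsometry ![ε, δ]) :=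
    { s_mul_a₁ := by
        rw [FreeGroup.signIsometry_mul_mulLeftIsometry, ← map_inv, FreeGroup.signHom_of]; simp
      s_mul_a₂ := by
        rw [FreeGroup.signIsometry_mul_mulLeftIsometry, FreeGroup.signHom_of]; simp
      s_mul_s := by
        rw [← map_mul, show (![-1, 1] * ![-1, 1] : Fin 2 → ℤˣ) = 1 by decide, map_one]
      s_mul_z := by rw [← map_mul, ← map_mul, mul_comm]
      z_mul_a₁ := by
        rw [FreeGroup.signIsometry_mul_mulLeftIsometry, ← map_zpow, FreeGroup.signHom_of]; simp
      z_mul_a₂ := by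
        rw [FreeGroup.signIsometry_mul_mulLeftIsometry, ← map_zpow, FreeGroup.signHom_of]; simp }
  obtain ⟨α, h₁, h₂, ht, hξ⟩ := h.exists_hom rel
  refine ⟨α, fun w n i => ?_⟩
  have e : α.comp (FreeGroup.lift ![x₁, x₂]) = FreeGroup.mulLeftIsometry := by
    refine FreeGroup.ext_hom _ _ fun i => ?_
    fin_cases i <;> simp [h₁, h₂]
  have e' : α (FreeGroup.lift ![x₁, x₂] w) = FreeGroup.mulLeftIsometry w := DFunLike.congr_fun e w
  rw [map_mul, map_mul, map_zpow, map_pow, e', ht, hξ, ← map_zpow, ← map_pow,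
    IsometryEquiv.mul_apply, IsometryEquiv.mul_apply, FreeGroup.signIsometry_apply,
    FreeGroup.signIsometry_apply, map_one, map_one, FreeGroup.mulLeftIsometry_apply, mul_one]

theorem exists_translation_hom (h : IsSignExtension ε δ x₁ x₂ t ξ) :
    ∃ β : G →* Multiplicative ℤ,
      ∀ (w : FreeGroup (Fin 2)) (n : ℤ) (i : ℕ),
        (β (FreeGroup.lift ![x₁, x₂] w * ξ ^ n * t ^ i)).toAdd = n := by
  have rel : SignRelations ε δ (1 : Multiplicative ℤ) 1 1 (Multiplicative.ofAdd 1) := by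
    constructor <;> simp
  obtain ⟨β, h₁, h₂, ht, hξ⟩ := h.exists_hom rel
  refine ⟨β, fun w n i => ?_⟩
  have e : β.comp (FreeGroup.lift ![x₁, x₂]) = 1 := by
    refine FreeGroup.ext_hom _ _ fun i => ?_
    fin_cases i <;> simp [h₁, h₂]
  have e' : β (FreeGroup.lift ![x₁, x₂] w) = 1 := DFunLike.congr_fun e w
  rw [map_mul β, map_mul β, map_zpow, map_pow, e', ht, hξ]
  simp [← ofAdd_zsmul]

/-- The group acts on the product of the Cayley tree of the free group and the real line. The free
group acts on the tree by left multiplication and trivially on the line, `t` and `ξ` act on the tree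
by automorphisms of the free group that preserve word lengths, and `ξ` translates the line. -/
theorem isCAT0Group (h : IsSignExtension ε δ x₁ x₂ t ξ) : IsCAT0Group G := by
  obtain ⟨α, hα⟩ := h.exists_isometry_hom
  obtain ⟨β, hβ⟩ := h.exists_translation_hom
  let act : MulAction G (WithLp 2 (TightSpan (FreeGroup (Fin 2)) × ℝ)) :=
    { smul := fun g x => WithLp.toLp 2 (α g • x.fst, ((β g).toAdd : ℝ) + x.snd)
      one_smul := fun x => by
        change WithLp.toLp 2 (α 1 • x.fst, ((β 1).toAdd : ℝ) + x.snd) = x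
        rw [map_one, map_one, one_smul, toAdd_one, Int.cast_zero, zero_add]
        rfl
      mul_smul := fun g g' x => by
        change WithLp.toLp 2 (α (g * g') • x.fst, ((β (g * g')).toAdd : ℝ) + x.snd) =
          WithLp.toLp 2 (α g • α g' • x.fst, ((β g).toAdd : ℝ) + ((β g').toAdd + x.snd))
        rw [map_mul, map_mul, mul_smul, toAdd_mul, Int.cast_add, add_assoc] }
  have smul_fst : ∀ (g : G) (x : WithLp 2 (TightSpan (FreeGroup (Fin 2)) × ℝ)),
      (g • x).fst = α g • x.fst := fun _ _ => rfl
  have smul_snd : ∀ (g : G) (x : WithLp 2 (TightSpan (FreeGroup (Fin 2)) × ℝ)),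
      (g • x).snd = ((β g).toAdd : ℝ) + x.snd := fun _ _ => rfl
  have isom : ∀ (g : G) (x y : WithLp 2 (TightSpan (FreeGroup (Fin 2)) × ℝ)),
      dist (g • x) (g • y) = dist x y := by
    intro g x y
    rw [← sq_eq_sq₀ dist_nonneg dist_nonneg, withLp_dist_sq, withLp_dist_sq, smul_fst, smul_fst,
      smul_snd, smul_snd, TightSpan.dist_smul, dist_add_left]
  refine ⟨_, inferInstance, act, ⟨WithLp.toLp 2 (TightSpan.vertex 1, 0)⟩,
    ((TightSpan.satisfiesCN FreeGroup.isZeroHyperbolic).withLp_prod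
      (satisfiesCN_of_innerProductSpace ℝ)).isCAT0Space, isom, ?_, ?_⟩
  · -- An element which moves `x` by less than `2` is determined up to finitely many possibilities
    -- by the image of the vertex `1` and the translation.
    intro x
    refine ⟨1, one_pos, ?_⟩
    have hfin := (((FreeGroup.finite_setOf_norm_le (α := Fin 2) ⌊2 + 2 * x.fst 1⌋₊).prod
      (Set.finite_Icc (-2 : ℤ) 2)).prod (Set.finite_univ (α := ZMod 2))).image
      fun p => FreeGroup.lift ![x₁, x₂] p.1.1 * ξ ^ p.1.2 * t ^ p.2.val
    refine hfin.subset ?_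
    rintro g ⟨_, ⟨y, hy, rfl⟩, hgy⟩
    rw [Metric.mem_ball] at hy hgy
    have hd : dist (g • x) x < 2 := by
      have := dist_triangle (g • x) (g • y) x
      rw [isom, dist_comm x y] at this
      linarith
    have hsq := withLp_dist_sq (g • x) x
    have hd₁ : dist (α g • x.fst) x.fst ≤ 2 := by
      rw [← smul_fst]
      exact (le_abs_self _).trans (abs_le_of_sq_le_sq
        (by nlinarith [sq_nonneg (dist (g • x).snd x.snd), dist_nonneg (x := g • x) (y := x)])
        zero_le_two)
    have hd₂ : dist (((β g).toAdd : ℝ) + x.snd) x.snd ≤ 2 := by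
      rw [← smul_snd]
      exact (le_abs_self _).trans (abs_le_of_sq_le_sq
        (by nlinarith [sq_nonneg (dist (g • x).fst x.fst), dist_nonneg (x := g • x) (y := x)])
        zero_le_two)
    obtain ⟨w, n, i, rfl⟩ := h.exists_eq g
    refine ⟨((w, n), i), ⟨⟨?_, ?_⟩, Set.mem_univ _⟩, rfl⟩
    · have k := TightSpan.dist_smul_vertex_le
        (α (FreeGroup.lift ![x₁, x₂] w * ξ ^ n * t ^ i.val)) 1 x.fst
      rw [hα, dist_comm, FreeGroup.dist_one_left] at k
      exact Nat.le_floor (by linarith)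
    · rw [hβ, Real.dist_eq, add_sub_cancel_right, abs_le] at hd₂
      exact ⟨by exact_mod_cast hd₂.1, by exact_mod_cast hd₂.2⟩
  · obtain ⟨K, hK, hmem⟩ := TightSpan.exists_isCompact (α := Fin 2)
    refine ⟨WithLp.toLp 2 '' (K ×ˢ Set.Icc (0 : ℝ) 1),
      (hK.prod isCompact_Icc).image (WithLp.prod_continuous_toLp 2 _ _), fun x => ?_⟩
    obtain ⟨v, hv⟩ := x.fst.exists_apply_le_one
    set g : G := FreeGroup.lift ![x₁, x₂] v * ξ ^ ⌊x.snd⌋ * t ^ 0 with hg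
    refine ⟨g, g⁻¹ • x, ⟨((g⁻¹ • x).fst, (g⁻¹ • x).snd), ⟨hmem _ ?_, ?_⟩, rfl⟩,
      smul_inv_smul g x⟩
    · rw [smul_fst, map_inv, TightSpan.smul_apply]
      change x.fst (α g 1) ≤ 1
      rwa [hα]
    · change (g⁻¹ • x).snd ∈ _
      rw [smul_snd, map_inv, toAdd_inv, hβ, Int.cast_neg]
      exact ⟨by linarith [Int.floor_le x.snd], by linarith [Int.lt_floor_add_one x.snd]⟩

end IsSignExtension

/-! ### The amalgam decomposition -/

theorem MonoidHom.comp_subtype_eq_of_closure {G P : Type*} [Group G] [Group P] {S : Set G}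
    {B : Subgroup G} (hB : B = Subgroup.closure S) {f : G →* P} {o : B →* P}
    (h : ∀ s ∈ S, ∀ hs : s ∈ B, f s = o ⟨s, hs⟩) : f.comp B.subtype = o := by
  subst hB
  ext ⟨g, hg⟩
  change f g = o ⟨g, hg⟩
  induction hg using Subgroup.closure_induction with
  | mem g hg => exact h g hg _
  | one => exact (map_one f).trans (map_one o).symm
  | mul x y hx hy ihx ihy =>
    rw [map_mul, ihx, ihy, ← map_mul]
    rfl
  | inv x hx ih =>
    rw [map_inv, ih, ← map_inv]
    rfl

namespace IsSignExtension

variable {ε δ : ℤˣ} {G : Type} [Group G] {x₁ x₂ t ξ : G}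

theorem closure_eq_top (h : IsSignExtension ε δ x₁ x₂ t ξ) :
    Subgroup.closure {x₁, x₂, t, ξ} = ⊤ := by
  rw [eq_top_iff]
  rintro g -
  obtain ⟨w, n, i, rfl⟩ := h.exists_eq g
  have hw : FreeGroup.lift ![x₁, x₂] w ∈ Subgroup.closure {x₁, x₂, t, ξ} := by
    have hr := FreeGroup.range_lift_le (f := ![x₁, x₂]) (s := Subgroup.closure {x₁, x₂, t, ξ}) (by
      rintro _ ⟨i, rfl⟩
      fin_cases i <;> exact Subgroup.subset_closure (by simp))
    exact hr ⟨w, rfl⟩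
  exact mul_mem (mul_mem hw (zpow_mem (Subgroup.subset_closure (by simp)) _))
    (pow_mem (Subgroup.subset_closure (by simp)) _)

/-- The universal property of `G` provides the inverse of the canonical map: each relation of `G`
involves only one of `x₁` and `x₂` and holds in one of the factors. -/
theorem isAmalgam (h : IsSignExtension ε δ x₁ x₂ t ξ) {A : Fin 2 → Subgroup G} {L : Subgroup G}
    (hA₀ : A 0 = Subgroup.closure {x₂, t, ξ}) (hA₁ : A 1 = Subgroup.closure {x₁, t, ξ})
    (hL : L = Subgroup.closure {t, ξ}) : IsAmalgam A L := by
  have hLA : ∀ i, L ≤ A i := by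
    rw [Fin.forall_fin_two, hA₀, hA₁, hL]
    exact ⟨Subgroup.closure_mono (Set.subset_insert _ _),
      Subgroup.closure_mono (Set.subset_insert _ _)⟩
  refine ⟨hLA, ?_⟩
  set ι : ∀ i, L →* A i := fun i => Subgroup.inclusion (hLA i)
  set Φ : Monoid.PushoutI ι →* G :=
    Monoid.PushoutI.lift (fun i => (A i).subtype) L.subtype (fun _ => rfl)
  have hΦof : ∀ i (g : A i), Φ (Monoid.PushoutI.of (φ := ι) i g) = g := fun _ g =>
    Monoid.PushoutI.lift_of (φ := ι) _ _ _ g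
  have hΦbase : ∀ g : L, Φ (Monoid.PushoutI.base ι g) = g := fun g =>
    Monoid.PushoutI.lift_base (φ := ι) _ _ _ g
  have mt : t ∈ L := hL ▸ Subgroup.subset_closure (by simp)
  have mξ : ξ ∈ L := hL ▸ Subgroup.subset_closure (by simp)
  have m₁ : x₁ ∈ A 1 := hA₁ ▸ Subgroup.subset_closure (by simp)
  have m₂ : x₂ ∈ A 0 := hA₀ ▸ Subgroup.subset_closure (by simp)
  let o₀ : A 0 →* Monoid.PushoutI ι := Monoid.PushoutI.of (φ := ι) 0
  let o₁ : A 1 →* Monoid.PushoutI ι := Monoid.PushoutI.of (φ := ι) 1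
  let b : L →* Monoid.PushoutI ι := Monoid.PushoutI.base ι
  have hb₀ : ∀ g (hg : g ∈ L), b ⟨g, hg⟩ = o₀ ⟨g, hLA 0 hg⟩ := fun g hg =>
    (Monoid.PushoutI.of_apply_eq_base ι 0 ⟨g, hg⟩).symm
  have hb₁ : ∀ g (hg : g ∈ L), b ⟨g, hg⟩ = o₁ ⟨g, hLA 1 hg⟩ := fun g hg =>
    (Monoid.PushoutI.of_apply_eq_base ι 1 ⟨g, hg⟩).symm
  have rel : SignRelations ε δ (o₁ ⟨x₁, m₁⟩) (o₀ ⟨x₂, m₂⟩) (b ⟨t, mt⟩) (b ⟨ξ, mξ⟩) :=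
    { s_mul_a₁ := by
        rw [hb₁, ← map_inv, ← map_mul, ← map_mul]
        exact congrArg o₁ (Subtype.ext h.rel.s_mul_a₁)
      s_mul_a₂ := by
        rw [hb₀, ← map_mul, ← map_mul]
        exact congrArg o₀ (Subtype.ext h.rel.s_mul_a₂)
      s_mul_s := by
        rw [← map_mul, ← map_one b]
        exact congrArg b (Subtype.ext h.rel.s_mul_s)
      s_mul_z := by
        rw [← map_mul, ← map_mul]
        exact congrArg b (Subtype.ext h.rel.s_mul_z)
      z_mul_a₁ := by
        rw [hb₁, ← map_zpow, ← map_mul, ← map_mul]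
        exact congrArg o₁ (Subtype.ext h.rel.z_mul_a₁)
      z_mul_a₂ := by
        rw [hb₀, ← map_zpow, ← map_mul, ← map_mul]
        exact congrArg o₀ (Subtype.ext h.rel.z_mul_a₂) }
  obtain ⟨Ψ, h₁, h₂, ht, hξ⟩ := h.exists_hom rel
  have hΨΦ : Ψ.comp Φ = MonoidHom.id _ := by
    refine Monoid.PushoutI.hom_ext (fun i => ?_) ?_
    · rw [MonoidHom.id_comp, MonoidHom.comp_assoc]
      have e : Φ.comp (Monoid.PushoutI.of i) = (A i).subtype :=
        MonoidHom.ext (hΦof i)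
      rw [e]
      match i with
      | 0 =>
        refine MonoidHom.comp_subtype_eq_of_closure hA₀ (o := o₀) ?_
        rintro s (rfl | rfl | rfl) _
        · exact h₂
        · exact ht.trans (hb₀ _ mt)
        · exact hξ.trans (hb₀ _ mξ)
      | 1 =>
        refine MonoidHom.comp_subtype_eq_of_closure hA₁ (o := o₁) ?_
        rintro s (rfl | rfl | rfl) _
        · exact h₁
        · exact ht.trans (hb₁ _ mt)
        · exact hξ.trans (hb₁ _ mξ)
    · rw [MonoidHom.id_comp, MonoidHom.comp_assoc]
      have e : Φ.comp (Monoid.PushoutI.base ι) = L.subtype :=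
        MonoidHom.ext hΦbase
      rw [e]
      refine MonoidHom.comp_subtype_eq_of_closure hL (o := b) ?_
      rintro s (rfl | rfl) _
      · exact ht
      · exact hξ
  have hΦΨ : Φ.comp Ψ = MonoidHom.id G := by
    refine MonoidHom.eq_of_eqOn_dense h.closure_eq_top ?_
    rintro s (rfl | rfl | rfl | rfl)
    · rw [MonoidHom.comp_apply, h₁]
      exact hΦof 1 _
    · rw [MonoidHom.comp_apply, h₂]
      exact hΦof 0 _
    · rw [MonoidHom.comp_apply, ht]
      exact hΦbase _
    · rw [MonoidHom.comp_apply, hξ]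
      exact hΦbase _
  exact ⟨Function.LeftInverse.injective (g := Ψ) fun p => DFunLike.congr_fun hΨΦ p,
    Function.RightInverse.surjective (g := Ψ) fun g => DFunLike.congr_fun hΦΨ g⟩

end IsSignExtension

/-! ### The isomorphism types of the subgroups -/

theorem nonempty_closure_mulEquiv {G M : Type*} [Group G] [Group M] {S : Set G} (r : G →* M)
    (j : M →* G) (hj : ∀ s ∈ S, j (r s) = s) (hr : Subgroup.closure (r '' S) = ⊤) :
    Nonempty (Subgroup.closure S ≃* M) := by
  have e : (j.comp r).comp (Subgroup.closure S).subtype = (Subgroup.closure S).subtype :=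
    MonoidHom.comp_subtype_eq_of_closure rfl fun s hs _ => hj s hs
  refine ⟨MulEquiv.ofBijective (r.comp (Subgroup.closure S).subtype) ⟨fun x y hxy => ?_, fun m => ?_⟩⟩
  · have hx := DFunLike.congr_fun e x
    have hy := DFunLike.congr_fun e y
    refine Subtype.ext (hx.symm.trans (Eq.trans ?_ hy))
    exact congrArg j hxy
  · have hm : m ∈ Subgroup.closure (r '' S) := hr ▸ Subgroup.mem_top m
    rw [← MonoidHom.map_closure] at hm
    obtain ⟨g, hg, rfl⟩ := hm
    exact ⟨⟨g, hg⟩, rfl⟩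

/-- The homomorphism from the infinite dihedral group given by an element `x` and an element `s` of
order two which inverts it. -/
def dihedralHom {P : Type*} [Group P] (x s : P) (hs : s * s = 1) (h : s * x = x⁻¹ * s) :
    DihedralGroup 0 →* P :=
  have hz : ∀ n : ℤ, x ^ n * s = s * x ^ (-n) := fun n => by
    have : SemiconjBy s x x⁻¹ := h
    have := this.zpow_right (-n)
    rw [SemiconjBy, inv_zpow', neg_neg] at this
    exact this.symm
  { toFun := fun
      | .r i => x ^ (show ℤ from i)
      | .sr i => s * x ^ (show ℤ from i)
    map_one' := zpow_zero x
    map_mul' := by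
      rintro (i | i) (j | j) <;> change ℤ at i j
      · exact zpow_add x i j
      · change s * x ^ (j - i) = x ^ i * (s * x ^ j)
        rw [← mul_assoc, hz, mul_assoc, ← zpow_add, neg_add_eq_sub]
      · change s * x ^ (i + j) = s * x ^ i * x ^ j
        rw [mul_assoc, zpow_add]
      · change x ^ (j - i) = s * x ^ i * (s * x ^ j)
        rw [mul_assoc s, ← mul_assoc _ s, hz, ← mul_assoc, ← mul_assoc, hs, one_mul, ← zpow_add,
          neg_add_eq_sub] }

namespace IsSignExtension

variable {ε δ : ℤˣ} {G : Type} [Group G] {x₁ x₂ t ξ : G}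

theorem nonempty_closure_t_ξ_mulEquiv (h : IsSignExtension ε δ x₁ x₂ t ξ) :
    Nonempty (Subgroup.closure {t, ξ} ≃* Multiplicative ℤ × Multiplicative (ZMod 2)) := by
  have rel : SignRelations ε δ (1 : Multiplicative ℤ × Multiplicative (ZMod 2)) 1
      (1, Multiplicative.ofAdd 1) (Multiplicative.ofAdd 1, 1) := by
    constructor <;> simp
    rfl
  obtain ⟨r, -, -, ht, hξ⟩ := h.exists_hom rel
  refine nonempty_closure_mulEquiv r ((zpowersHom G ξ).noncommCoprod (zmodTwoHom t h.rel.s_mul_s)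
    fun n i => ?_) ?_ ?_
  · rw [zpowersHom_apply, zmodTwoHom_apply]
    exact (h.rel.commute_z_s.zpow_left _).pow_right _
  · rintro s (rfl | rfl)
    · rw [ht]; simp
    · rw [hξ]; simp
  · rw [Set.image_pair, ht, hξ, Set.pair_comm]
    exact closure_prod_zmodTwo

theorem nonempty_closure_x₂_mulEquiv (h : IsSignExtension ε 1 x₁ x₂ t ξ) :
    Nonempty (Subgroup.closure {x₂, t, ξ} ≃*
      (Multiplicative ℤ × Multiplicative ℤ) × Multiplicative (ZMod 2)) := by
  set M := (Multiplicative ℤ × Multiplicative ℤ) × Multiplicative (ZMod 2)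
  have rel : SignRelations ε 1 (1 : M) ((Multiplicative.ofAdd 1, 1), 1)
      (1, Multiplicative.ofAdd 1) ((1, Multiplicative.ofAdd 1), 1) := by
    constructor <;> simp [M]
    rfl
  obtain ⟨r, -, h₂, ht, hξ⟩ := h.exists_hom rel
  have hc : Commute x₂ ξ := by
    have := h.rel.z_mul_a₂
    rw [Units.val_one, zpow_one] at this
    exact this.symm
  have hc' : ∀ m n, Commute (zpowersHom G x₂ m) (zpowersHom G ξ n) := fun m n => by
    rw [zpowersHom_apply, zpowersHom_apply]
    exact (hc.zpow_left _).zpow_right _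
  refine nonempty_closure_mulEquiv r (((zpowersHom G x₂).noncommCoprod (zpowersHom G ξ)
    hc').noncommCoprod (zmodTwoHom t h.rel.s_mul_s) fun n i => ?_) ?_ ?_
  · rw [zmodTwoHom_apply, MonoidHom.noncommCoprod_apply, zpowersHom_apply, zpowersHom_apply]
    exact (((show Commute x₂ t from h.rel.s_mul_a₂.symm).zpow_left _).mul_left
      (h.rel.commute_z_s.zpow_left _)).pow_right _
  · rintro s (rfl | rfl | rfl)
    · rw [h₂]; simp
    · rw [ht]; simp
    · rw [hξ]; simp
  · rw [Set.image_insert_eq, Set.image_pair, h₂, ht, hξ, eq_top_iff]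
    rintro ⟨⟨a, b⟩, c⟩ -
    have e : ((a, b), c) = ((Multiplicative.ofAdd 1, 1), 1) ^ a.toAdd *
        (((1, Multiplicative.ofAdd 1), 1) ^ b.toAdd * (1, Multiplicative.ofAdd 1) ^ c.toAdd.val :
          M) := by
      refine Prod.ext (Prod.ext ?_ ?_) ?_ <;> simp [M, ← ofAdd_zsmul, ofAdd_one_pow_val]
    rw [e]
    exact mul_mem (zpow_mem (Subgroup.subset_closure (by simp)) _)
      (mul_mem (zpow_mem (Subgroup.subset_closure (by simp)) _)
        (pow_mem (Subgroup.subset_closure (by simp)) _))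

theorem nonempty_closure_x₂_mulEquiv_of_neg (h : IsSignExtension ε (-1) x₁ x₂ t ξ) :
    Nonempty (Subgroup.closure {x₂, t, ξ} ≃*
      Multiplicative (ZMod 2) × (Multiplicative ℤ ⋊[inversionAction] Multiplicative ℤ)) := by
  set N := Multiplicative ℤ ⋊[inversionAction] Multiplicative ℤ
  have hinv : ∀ n : Multiplicative ℤ, inversionAction (Multiplicative.ofAdd 1) n = n⁻¹ := by
    intro n
    simp [inversionAction]
  set a : N := SemidirectProduct.inl (Multiplicative.ofAdd 1) with ha
  set b : N := SemidirectProduct.inr (Multiplicative.ofAdd 1) with hb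
  have hba : b * a = a⁻¹ * b := by
    have := SemidirectProduct.inl_aut (φ := inversionAction) (Multiplicative.ofAdd 1)
      (Multiplicative.ofAdd 1)
    rw [hinv, map_inv] at this
    rw [ha, hb, this, mul_assoc, ← map_mul, inv_mul_cancel, map_one SemidirectProduct.inr, mul_one]
  have rel : SignRelations ε (-1) (1 : Multiplicative (ZMod 2) × N) (1, a)
      (Multiplicative.ofAdd 1, 1) (1, b) := by
    constructor <;> simp [hba]
    rfl
  obtain ⟨r, -, h₂, ht, hξ⟩ := h.exists_hom rel
  have hξx : ξ * x₂ = x₂⁻¹ * ξ := by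
    have := h.rel.z_mul_a₂
    rwa [Units.val_neg, Units.val_one, zpow_neg, zpow_one] at this
  have hpow : ∀ n : Multiplicative ℤ, Multiplicative.ofAdd (1 : ℤ) ^ n.toAdd = n := fun n => by
    simp [← ofAdd_zsmul]
  have hcl : Subgroup.closure {(Multiplicative.ofAdd 1 : Multiplicative ℤ)} = ⊤ := by
    rw [eq_top_iff]
    rintro n -
    rw [← hpow n]
    exact zpow_mem (Subgroup.subset_closure (Set.mem_singleton _)) _
  have hcompat := SemidirectProduct.comp_eq_conj_comp_of_closure (φ := inversionAction)
    (f₁ := zpowersHom G x₂) (f₂ := zpowersHom G ξ) hcl (by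
      rintro _ rfl
      refine MonoidHom.ext_mint ?_
      change x₂ ^ (inversionAction (Multiplicative.ofAdd 1) (Multiplicative.ofAdd 1)).toAdd =
        ξ ^ (1 : ℤ) * x₂ ^ (1 : ℤ) * (ξ ^ (1 : ℤ))⁻¹
      rw [hinv, toAdd_inv, toAdd_ofAdd, zpow_neg, zpow_one, zpow_one]
      rw [hξx, mul_inv_cancel_right])
  refine nonempty_closure_mulEquiv r ((zmodTwoHom t h.rel.s_mul_s).noncommCoprod
    (SemidirectProduct.lift (zpowersHom G x₂) (zpowersHom G ξ) hcompat) fun i n => ?_) ?_ ?_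
  · rw [zmodTwoHom_apply]
    change Commute _ (x₂ ^ n.left.toAdd * ξ ^ n.right.toAdd)
    exact (((show Commute t x₂ from h.rel.s_mul_a₂).zpow_right _).mul_right
      (h.rel.commute_z_s.symm.zpow_right _)).pow_left _
  · rintro s (rfl | rfl | rfl)
    · rw [h₂]; simp [ha]
    · rw [ht]; simp
    · rw [hξ]; simp [hb]
  · rw [Set.image_insert_eq, Set.image_pair, h₂, ht, hξ, eq_top_iff]
    rintro ⟨c, n⟩ -
    have e : (c, n) = ((1, a) ^ n.left.toAdd * (1, b) ^ n.right.toAdd *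
        (Multiplicative.ofAdd 1, 1) ^ c.toAdd.val : Multiplicative (ZMod 2) × N) := by
      refine Prod.ext ?_ ?_
      · simp [ofAdd_one_pow_val]
      · simp only [Prod.snd_mul, Prod.pow_snd, one_pow, mul_one, ha, hb]
        rw [← map_zpow SemidirectProduct.inl, ← map_zpow SemidirectProduct.inr, hpow, hpow,
          SemidirectProduct.inl_left_mul_inr_right]
    rw [e]
    exact mul_mem (mul_mem (zpow_mem (Subgroup.subset_closure (by simp)) _)
      (zpow_mem (Subgroup.subset_closure (by simp)) _))
        (pow_mem (Subgroup.subset_closure (by simp)) _)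

/-- The element `ξ` if `ε = 1` and `ξ t` if `ε = -1` commutes with `x₁` and `t` and generates the
factor `ℤ`. -/
theorem nonempty_closure_x₁_mulEquiv (h : IsSignExtension ε δ x₁ x₂ t ξ) :
    Nonempty (Subgroup.closure {x₁, t, ξ} ≃* Multiplicative ℤ × DihedralGroup 0) := by
  set M := Multiplicative ℤ × DihedralGroup 0
  set D : DihedralGroup 0 →* G := dihedralHom x₁ t h.rel.s_mul_s h.rel.s_mul_a₁
  have Dr : D (.r 1) = x₁ := zpow_one x₁
  have Ds : D (.sr 0) = t := (congrArg (t * ·) (zpow_zero x₁)).trans (mul_one t)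
  have hsr : (DihedralGroup.sr 0 : DihedralGroup 0) * .r 1 = (.r 1)⁻¹ * .sr 0 := by simp
  -- `y` is the generator of the factor `ℤ`, and `d` is the dihedral component of `ξ`
  obtain ⟨y, d, hyx, hyt, hyd, hds, hdr⟩ : ∃ (y : G) (d : DihedralGroup 0), Commute y x₁ ∧
      Commute y t ∧ y * D d = ξ ∧ .sr 0 * d = d * .sr 0 ∧ d * .r 1 = (.r 1) ^ (ε : ℤ) * d := by
    have hξ := h.rel.z_mul_a₁
    rcases Int.units_eq_one_or ε with rfl | rfl
    · rw [Units.val_one, zpow_one] at hξ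
      exact ⟨ξ, 1, hξ, h.rel.commute_z_s, by simp, by simp, by simp⟩
    · rw [Units.val_neg, Units.val_one, zpow_neg, zpow_one] at hξ
      refine ⟨ξ * t, .sr 0, ?_, h.rel.commute_z_s.mul_left (Commute.refl t), ?_, rfl, ?_⟩
      · change ξ * t * x₁ = x₁ * (ξ * t)
        have hξ' : ξ * x₁⁻¹ = x₁ * ξ := by
          rw [mul_inv_eq_iff_eq_mul, mul_assoc, hξ, mul_inv_cancel_left]
        rw [mul_assoc, h.rel.s_mul_a₁, ← mul_assoc, hξ', mul_assoc]
      · rw [Ds, mul_assoc, h.rel.s_mul_s, mul_one]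
      · simp
  have rel : SignRelations ε δ ((1, .r 1) : M) 1 (1, .sr 0) (Multiplicative.ofAdd 1, d) := by
    constructor
    · exact Prod.ext (by simp) hsr
    · simp
    · exact Prod.ext (by simp) (by simp)
    · exact Prod.ext (by simp) hds
    · exact Prod.ext (by simp) hdr
    · simp
  obtain ⟨r, h₁, -, ht, hξ⟩ := h.exists_hom rel
  have hyD : ∀ g, Commute y (D g) := by
    rintro (i | i)
    · exact hyx.zpow_right _
    · exact hyt.mul_right (hyx.zpow_right _)
  refine nonempty_closure_mulEquiv r ((zpowersHom G y).noncommCoprod D fun n g => ?_) ?_ ?_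
  · rw [zpowersHom_apply]
    exact (hyD g).zpow_left _
  · rintro s (rfl | rfl | rfl)
    · rw [h₁]; simp [Dr]
    · rw [ht]; simp [Ds]
    · rw [hξ]; simp [hyd]
  · rw [Set.image_insert_eq, Set.image_pair, h₁, ht, hξ, eq_top_iff]
    set C := Subgroup.closure {((1, .r 1) : M), (1, .sr 0), (Multiplicative.ofAdd 1, d)}
    have hr : ((1, .r 1) : M) ∈ C := Subgroup.subset_closure (by simp)
    have hs : ((1, .sr 0) : M) ∈ C := Subgroup.subset_closure (by simp)
    have hd : ((Multiplicative.ofAdd 1, d) : M) ∈ C := Subgroup.subset_closure (by simp)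
    have hri : ∀ i : ℤ, ((1, .r i) : M) ∈ C := fun i => by
      have e : ((1, .r i) : M) = (1, .r 1) ^ i := by
        refine Prod.ext (by simp) ?_
        rw [Prod.pow_snd, DihedralGroup.r_one_zpow]
        exact congrArg DihedralGroup.r Int.cast_id.symm
      exact e ▸ zpow_mem hr i
    have hg : ∀ g : DihedralGroup 0, ((1, g) : M) ∈ C := by
      rintro (i | i)
      · exact hri i
      · have e : ((1, .sr i) : M) = (1, .sr 0) * (1, .r i) := Prod.ext (by simp) (by simp)
        exact e ▸ mul_mem hs (hri i)
    rintro ⟨n, g⟩ -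
    have e : ((n, g) : M) = (Multiplicative.ofAdd 1, d) ^ n.toAdd *
        (1, (d ^ n.toAdd)⁻¹ * g) := by
      refine Prod.ext ?_ ?_
      · simp [← ofAdd_zsmul]
      · simp
    rw [e]
    exact mul_mem (zpow_mem hd _) (hg _)

end IsSignExtension

theorem mainTheorem7
    (k : ℤ) (ε δ : ℤˣ)
    (φ : Multiplicative ℤ × Multiplicative (ZMod 2) →* MulAut (FreeGroup (Fin 2)))
    (h₁₁ : φ (1, Multiplicative.ofAdd 1) (FreeGroup.of 0) = (FreeGroup.of 0)⁻¹)
    (h₁₂ : φ (1, Multiplicative.ofAdd 1) (FreeGroup.of 1) = FreeGroup.of 1)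
    (h₂₁ : φ (Multiplicative.ofAdd 1, 1) (FreeGroup.of 0) =
      FreeGroup.of 1 ^ k * FreeGroup.of 0 ^ (ε : ℤ) * FreeGroup.of 1 ^ (-k))
    (h₂₂ : φ (Multiplicative.ofAdd 1, 1) (FreeGroup.of 1) = FreeGroup.of 1 ^ (δ : ℤ)) :
    let G := FreeGroup (Fin 2) ⋊[φ] (Multiplicative ℤ × Multiplicative (ZMod 2))
    let x₁ : G := SemidirectProduct.inl (FreeGroup.of 0)
    let x₂ : G := SemidirectProduct.inl (FreeGroup.of 1)
    let t₁ : G := SemidirectProduct.inr (1, Multiplicative.ofAdd 1)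
    let t₂ : G := SemidirectProduct.inr (Multiplicative.ofAdd 1, 1)
    let ξ : G := x₂ ^ (-k) * t₂
    let L₁ : Subgroup G := Subgroup.closure {x₂, t₁, ξ}
    let L₂ : Subgroup G := Subgroup.closure {x₁, t₁, ξ}
    let L : Subgroup G := Subgroup.closure {t₁, ξ}
    IsCAT0Group G ∧
    IsAmalgam ![L₁, L₂] L ∧
    (δ = 1 →
      Nonempty (L₁ ≃* (Multiplicative ℤ × Multiplicative ℤ) × Multiplicative (ZMod 2))) ∧
    (δ = -1 →
      Nonempty (L₁ ≃*
        Multiplicative (ZMod 2) × (Multiplicative ℤ ⋊[inversionAction] Multiplicative ℤ))) ∧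
    Nonempty (L₂ ≃* Multiplicative ℤ × DihedralGroup 0) ∧
    Nonempty (L ≃* Multiplicative ℤ × Multiplicative (ZMod 2)) := by
  intro G x₁ x₂ t₁ t₂ ξ L₁ L₂ L
  have h : IsSignExtension ε δ x₁ x₂ t₁ ξ :=
    isSignExtension_semidirectProduct k ε δ φ h₁₁ h₁₂ h₂₁ h₂₂
  refine ⟨h.isCAT0Group, h.isAmalgam rfl rfl rfl, ?_, ?_, h.nonempty_closure_x₁_mulEquiv,
    h.nonempty_closure_t_ξ_mulEquiv⟩
  · rintro rfl
    exact h.nonempty_closure_x₂_mulEquiv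
  · rintro rfl
    exact h.nonempty_closure_x₂_mulEquiv_of_neg
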